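/- Let $\Gamma$ be a totally ordered abelian group with positive cone $\Gamma^+=\{x\in\Gamma: 0\le x\}$ and let $\mathcal A$ be a unital $C^*$-algebra. An action of $\Gamma^+$ on $\mathcal A$ is a family $\mathcal V=\{\mathcal V_x\}_{x\in\Gamma^+}$ of (automatically bounded) positive linear maps on $\mathcal A$ with $\mathcal V_0=\mathrm{Id}$ and $\mathcal V_x\circ\mathcal V_y=\mathcal V_{x+y}$. A covariant representation $(C,\sigma,U)$ of $\mathcal V$ consists of a unital $C^*$-algebra $C$, an injective unital $*$-homomorphism $\sigma:\mathcal A\to C$ and a map $U:\Gamma^+\to C$ with $U_{x+y}=U_xU_y$ such that each $U_x$ is a partial isometry and, for all $a\in\mathcal A$ and $x\in\Gamma^+$, $$\sigma(\mathcal V_x(a))=U_x\sigma(a)U_x^*,\qquad U_x^*\sigma(a)U_x\in\sigma(\mathcal A).$$ The action $\mathcal V$ is finely representable if it has a covariant representation. In that case there is a unique action $\mathcal H$ such that $(\mathcal V,\mathcal H)$ is a complete interaction, i.e. for all $x,y\in\Gamma^+$ and $a,b\in\mathcal A$: - $\mathcal V_x\mathcal H_x\mathcal V_x=\mathcal V_x$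 and $\mathcal H_x\mathcal V_x\mathcal H_x=\mathcal H_x$; - $\mathcal V_x(ab)=\mathcal V_x(a)\mathcal V_x(b)$ if $a$ or $b$ lies in $\mathcal H_x(\mathcal A)$, and $\mathcal H_x(ab)=\mathcal H_x(a)\mathcal H_x(b)$ if $a$ or $b$ lies in $\mathcal V_x(\mathcal A)$; - $\mathcal H_x(\mathcal V_x(a))=\mathcal H_x(1)a\mathcal H_x(1)$, $\mathcal V_x(\mathcal H_x(a))=\mathcal V_x(1)a\mathcal V_x(1)$ and $\mathcal H_y(1)\mathcal V_x(1)=\mathcal V_x(1)\mathcal H_y(1)$. The crossed product $\mathcal A\rtimes_{(\mathcal V,\mathcal H)}\Gamma$ is the universal unital $C^*$-algebra generated by a copy of $\mathcal A$ and partial isometries $\{\hat U_x\}_{x\in\Gamma^+}$ subject to $\mathcal V_x(a)=\hat U_xa\hat U_x^*$, $\mathcal H_x(a)=\hat U_x^*a\hat U_x$ and $\hat U_x\hat U_y=\hat U_{x+y}$. For a covariant representation $(C,\sigma,U)$ of $\mathcal V$, let $\sigma\times U:\mathcal A\rtimes_{(\mathcal V,\mathcal H)}\Gamma\to C$ be the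 $*$-homomorphism with $(\sigma\times U)(a)=\sigma(a)$ and $(\sigma\times U)(\hat U_x)=U_x$. Let $C_0$ be the $*$-subalgebra of $\mathcal A\rtimes_{(\mathcal V,\mathcal H)}\Gamma$ generated by $\mathcal A$ and the $\hat U_x$; it is dense. A quasi-monomial of degree $x$ of positive (negative) type is a finite sum of monomials $a_1\hat U_{x_1}\cdots a_n\hat U_{x_n}$ (respectively $a_1\hat U_{x_1}^*\cdots a_n\hat U_{x_n}^*$) with $a_i\in\mathcal A$, $x_i\in\Gamma^+$, $x_1+\dots+x_n=x$. Every $a\in C_0$ has a presentation $$a=\sum_{x\in F}q_{-x}+a_0+\sum_{x\in F}q_x$$ with $F\subset\Gamma^+\setminus\{0\}$ finite, $q_{x}$ and $q_{-x}$ quasi-monomials of degree $x$ of positive and negative type respectively, and $a_0\in\mathcal A$; the element $E_0(a):=a_0$ depends only on $a$. We say that $(C,\sigma,U)$ has property $(*)$ if $$\|a_0\|=\|E_0(a)\|\le\|(\sigma\times U)(a)\|$$ for every $a\in C_0$ and every such presentation of $a$. **Theorem.** Let $\mathcal V$ be a finely representable action of $\Gamma^+$ on $\mathcal A$, $(\mathcal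 V,\mathcal H)$ the corresponding complete interaction, and $(C,\sigma,U)$ a covariant representation of $\mathcal V$. Then $\sigma\times U:\mathcal A\rtimes_{(\mathcal V,\mathcal H)}\Gamma\to C$ is injective if and only if $(C,\sigma,U)$ has property $(*)$. -/

import Mathlib

set_option linter.unusedSectionVars false

noncomputable section

namespace SemigroupInteraction

universe u v w

/-- The positive cone `Γ⁺ = {x ∈ Γ : 0 ≤ x}` of a totally ordered abelian group `Γ`,
an additive commutative monoid. -/
abbrev PosCone (Γ : Type v) [AddCommGroup Γ] [LinearOrder Γ] : Type v := {x : Γ // 0 ≤ x}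

section Actions

variable (Γ : Type v) [AddCommGroup Γ] [LinearOrder Γ] [IsOrderedAddMonoid Γ]
variable (A : Type u) [CStarAlgebra A] [PartialOrder A] [StarOrderedRing A]

/-- An action of `Γ⁺` on a unital C⋆-algebra `A`: a semigroup homomorphism from `Γ⁺` to the positive
linear maps on `A` (which are automatically bounded) under composition. -/
structure Action where
  /-- The positive linear map `V_x`. -/
  toFun : PosCone Γ → (A →ₚ[ℂ] A)
  map_zero' : ∀ a : A, toFun 0 a = a
  map_add' : ∀ (x y : PosCone Γ) (a : A), toFun (x + y) a = toFun x (toFun y a)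

variable {Γ A}

instance : CoeFun (Action Γ A) (fun _ => PosCone Γ → (A →ₚ[ℂ] A)) := ⟨Action.toFun⟩

/-- A pair of actions `(V, H)` is an interaction. -/
structure IsInteraction (V H : Action Γ A) : Prop where
  vhv : ∀ (x : PosCone Γ) (a : A), V x (H x (V x a)) = V x a
  hvh : ∀ (x : PosCone Γ) (a : A), H x (V x (H x a)) = H x a
  map_mul_left : ∀ (x : PosCone Γ) (a b : A),
    a ∈ Set.range (H x) ∨ b ∈ Set.range (H x) → V x (a * b) = V x a * V x b
  map_mul_right : ∀ (x : PosCone Γ) (a b : A),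
    a ∈ Set.range (V x) ∨ b ∈ Set.range (V x) → H x (a * b) = H x a * H x b

/-- A complete interaction. -/
structure IsCompleteInteraction (V H : Action Γ A) : Prop extends IsInteraction V H where
  hv : ∀ (x : PosCone Γ) (a : A), H x (V x a) = H x 1 * a * H x 1
  vh : ∀ (x : PosCone Γ) (a : A), V x (H x a) = V x 1 * a * V x 1
  comm : ∀ x y : PosCone Γ, H y 1 * V x 1 = V x 1 * H y 1

/-- A covariant representation `(C, σ, U)` of the action `V` in a unital C⋆-algebra `C`.
The action `V` is finely representable when it has one. -/
structure CovariantRep (V : Action Γ A) (C : Type w) [CStarAlgebra C] where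
  /-- The unital monomorphism `σ : A → C`. -/
  σ : A →⋆ₐ[ℂ] C
  injective : Function.Injective σ
  /-- The partial isometries `U_x`. -/
  U : PosCone Γ → C
  U_add : ∀ x y : PosCone Γ, U (x + y) = U x * U y
  partialIsometry : ∀ x : PosCone Γ, U x * star (U x) * U x = U x
  map_action : ∀ (x : PosCone Γ) (a : A), σ (V x a) = U x * σ a * star (U x)
  mem_range : ∀ (x : PosCone Γ) (a : A), star (U x) * σ a * U x ∈ Set.range σ

namespace CovariantRep

variable {V H : Action Γ A} {C : Type w} [CStarAlgebra C] (R : CovariantRep V C)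

lemma partialIsometry_star (x : PosCone Γ) :
    star (R.U x) * R.U x * star (R.U x) = star (R.U x) := by
  have := congrArg star (R.partialIsometry x)
  simpa [mul_assoc] using this

/-- In every covariant representation of `V`, the second member `H` of a complete interaction
`(V, H)` is implemented by the adjoints of the partial isometries. -/
theorem map_companion (h : IsCompleteInteraction V H) (x : PosCone Γ) (a : A) :
    R.σ (H x a) = star (R.U x) * R.σ a * R.U x := by
  set U := R.U x with hU
  set σ := R.σ with hσ
  have hp : U * star U * U = U := R.partialIsometry x
  have hp' : star U * U * star U = star U := R.partialIsometry_star x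
  obtain ⟨P', hP'⟩ := R.mem_range x 1
  have hP'' : σ P' = star U * U := by rw [← hU, ← hσ] at hP'; rw [hP']; simp
  -- kernel of `V_x`
  have hker : ∀ b : A, V x b = 0 → P' * b * P' = 0 := by
    intro b hb
    apply R.injective
    rw [← hσ]
    have h1 : U * σ b * star U = 0 := by rw [hσ, hU, ← R.map_action, hb, map_zero]
    rw [map_mul, map_mul, hP'', map_zero]
    calc star U * U * σ b * (star U * U) = star U * (U * σ b * star U) * U := by
          simp only [mul_assoc]
      _ = 0 := by rw [h1]; simp
  have hV1 : σ (V x 1) = U * star U := by rw [hσ, R.map_action]; simp [hU]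
  have hVP' : V x P' = V x 1 := by
    apply R.injective
    rw [← hσ, hV1, hσ, R.map_action, ← hσ, ← hU, hP'']
    rw [← mul_assoc U, hp]
  have hVV : V x 1 * V x 1 = V x 1 := by
    apply R.injective
    rw [← hσ, map_mul, hV1, ← mul_assoc, hp]
  set P := H x 1 with hP
  have hVP : V x P = V x 1 := by rw [hP, h.vh]; simp [hVV]
  have hPP : P * P = P := by
    have := h.hv x 1
    rw [← hVP, ← hP, hP, h.hvh, ← hP] at this
    simpa using this.symm
  have hPs : star P = P := by
    have : IsSelfAdjoint P := by
      have h0 : (0 : A) ≤ P := by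
        have := (H x).monotone' (zero_le_one (α := A))
        have h2 : H x 0 ≤ H x 1 := this
        simpa [map_zero] using h2
      exact IsSelfAdjoint.of_nonneg h0
    exact this
  have hP's : star P' = P' := by
    apply R.injective; rw [← hσ, map_star, hP'']; simp
  have hP'P' : P' * P' = P' := by
    apply R.injective; rw [← hσ, map_mul, hP'', ← mul_assoc, hp']
  -- `P' ≤ P`
  have e1 : P * P' = P' := by
    have h0 := hker (1 - P) (by rw [map_sub, hVP, sub_self])
    have h1 : star ((1 - P) * P') * ((1 - P) * P') = 0 := by
      rw [star_mul, star_sub, star_one, hPs, hP's]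
      have : (1 - P) * (1 - P) = 1 - P := by simp [mul_sub, sub_mul, hPP]
      calc P' * (1 - P) * ((1 - P) * P') = P' * ((1 - P) * (1 - P)) * P' := by
            simp only [mul_assoc]
        _ = 0 := by rw [this, h0]
    have h2 := CStarRing.star_mul_self_eq_zero_iff _ |>.1 h1
    rw [sub_mul, one_mul, sub_eq_zero] at h2
    exact h2.symm
  have e2 : P' * P = P := by
    have h0 : P * (1 - P') * P = 0 := by
      rw [hP, ← h.hv, map_sub, hVP', sub_self, map_zero]
    have h1 : star ((1 - P') * P) * ((1 - P') * P) = 0 := by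
      rw [star_mul, star_sub, star_one, hPs, hP's]
      have : (1 - P') * (1 - P') = 1 - P' := by simp [mul_sub, sub_mul, hP'P']
      calc P * (1 - P') * ((1 - P') * P) = P * ((1 - P') * (1 - P')) * P := by
            simp only [mul_assoc]
        _ = 0 := by rw [this, h0]
    have h2 := CStarRing.star_mul_self_eq_zero_iff _ |>.1 h1
    rw [sub_mul, one_mul, sub_eq_zero] at h2
    exact h2.symm
  have e3 : P * P' = P := by
    have := congrArg star e2
    simpa [hPs, hP's] using this
  have ePP : P' = P := e1.symm.trans e3
  obtain ⟨c, hc⟩ := R.mem_range x a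
  rw [← hσ, ← hU] at hc
  have hVc : V x (H x a) = V x c := by
    rw [h.vh]
    apply R.injective
    rw [← hσ, map_mul, map_mul, hV1]
    rw [hσ, R.map_action, ← hσ, ← hU, hc]
    simp only [mul_assoc]
  have hz := hker (H x a - c) (by rw [map_sub, hVc, sub_self])
  have hHa : P' * H x a * P' = H x a := by
    rw [ePP, hP, ← h.hv, h.hvh]
  have hcc : P' * c * P' = c := by
    apply R.injective
    rw [← hσ, map_mul, map_mul, hP'', hc]
    calc star U * U * (star U * σ a * U) * (star U * U)
        = (star U * U * star U) * σ a * (U * star U * U) := by simp only [mul_assoc]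
      _ = _ := by rw [hp, hp']
  have : H x a = c := by
    rw [mul_sub, sub_mul, hHa, hcc] at hz
    exact sub_eq_zero.1 hz
  rw [this, hc]

end CovariantRep

section Existence

namespace CovariantRep

variable {V H : Action Γ A} {C : Type w} [CStarAlgebra C] (R : CovariantRep V C)

/-- An injective ⋆-homomorphism reflects positivity. -/
lemma nonneg_of_map_eq (a : A) (c : C) (h : R.σ a = star c * c) : 0 ≤ a := by
  let _ := CStarAlgebra.spectralOrder C
  have _ := CStarAlgebra.spectralOrderedRing C
  have hs : IsSelfAdjoint a := by
    apply R.injective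
    rw [map_star, h, star_mul, star_star]
  obtain ⟨e, he⟩ := CStarAlgebra.nonneg_iff_eq_star_mul_self.1 (CFC.negPart_nonneg a)
  have hns : star a⁻ = a⁻ := (IsSelfAdjoint.of_nonneg (CFC.negPart_nonneg a))
  have h1 : a⁻ * a * a⁻ = - (star (e * a⁻) * (e * a⁻)) := by
    have h3 : a⁻ * a = - (a⁻ * a⁻) := by
      calc a⁻ * a = a⁻ * (a⁺ - a⁻) := by rw [CFC.posPart_sub_negPart a hs]
        _ = _ := by rw [mul_sub, CFC.negPart_mul_posPart, zero_sub]
    rw [h3, star_mul, hns, neg_mul]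
    congr 1
    calc a⁻ * a⁻ * a⁻ = a⁻ * (star e * e) * a⁻ := by rw [← he]
      _ = _ := by simp only [mul_assoc]
  have h2 : star (c * R.σ a⁻) * (c * R.σ a⁻) = - (star (R.σ (e * a⁻)) * R.σ (e * a⁻)) := by
    rw [← map_star, ← map_mul, ← map_neg, ← h1, map_mul, map_mul, h, star_mul, ← map_star, hns]
    simp only [mul_assoc]
  have h3 : star (R.σ (e * a⁻)) * R.σ (e * a⁻) = 0 := by
    apply le_antisymm _ (star_mul_self_nonneg _)
    have := star_mul_self_nonneg (c * R.σ a⁻)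
    rw [h2] at this
    exact neg_nonneg.1 this
  have h4 : e * a⁻ = 0 := by
    apply R.injective
    rw [map_zero]
    exact (CStarRing.star_mul_self_eq_zero_iff _).1 h3
  have h5 : a⁻ = 0 := by
    apply (CStarRing.star_mul_self_eq_zero_iff _).1
    rw [hns]
    conv_lhs => rw [show a⁻ * a⁻ = star e * e * a⁻ by rw [← he]]
    rw [mul_assoc, h4, mul_zero]
  rw [← CFC.posPart_sub_negPart a hs, h5, sub_zero]
  exact CFC.posPart_nonneg a

/-- The element `H_x(a)` with `σ(H_x(a)) = U_x⋆ σ(a) U_x`. -/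
def companionFun (x : PosCone Γ) (a : A) : A := (R.mem_range x a).choose

lemma σ_companionFun (x : PosCone Γ) (a : A) :
    R.σ (R.companionFun x a) = star (R.U x) * R.σ a * R.U x := (R.mem_range x a).choose_spec

lemma U_zero : R.U 0 = 1 := by
  have h1 : R.U 0 * star (R.U 0) = 1 := by
    have := R.map_action 0 1
    rw [V.map_zero', map_one, mul_one] at this
    exact this.symm
  have h2 : R.U 0 * R.U 0 = R.U 0 := by rw [← R.U_add, add_zero]
  calc R.U 0 = R.U 0 * (R.U 0 * star (R.U 0)) := by rw [h1, mul_one]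
    _ = 1 := by rw [← mul_assoc, h2, h1]

/-- The action `H` implemented by the adjoints `U_x⋆`. -/
def companion : Action Γ A where
  toFun x :=
    { toFun := R.companionFun x
      map_add' := fun a b => R.injective (by
        rw [map_add, σ_companionFun, σ_companionFun, σ_companionFun, map_add, mul_add, add_mul])
      map_smul' := fun c a => R.injective (by
        rw [RingHom.id_apply, map_smul, σ_companionFun, σ_companionFun, map_smul, mul_smul_comm,
          smul_mul_assoc])
      monotone' := fun a b hab => by
        obtain ⟨e, he⟩ := CStarAlgebra.nonneg_iff_eq_star_mul_self.1 (sub_nonneg.2 hab)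
        rw [← sub_nonneg]
        apply R.nonneg_of_map_eq _ (R.σ e * R.U x)
        rw [map_sub, σ_companionFun, σ_companionFun, ← sub_mul, ← mul_sub, ← map_sub, he, map_mul,
          map_star, star_mul]
        simp only [mul_assoc] }
  map_zero' a := R.injective (by
    change R.σ (R.companionFun 0 a) = _
    rw [σ_companionFun, U_zero]; simp)
  map_add' x y a := R.injective (by
    change R.σ (R.companionFun (x + y) a) = R.σ (R.companionFun x (R.companionFun y a))
    rw [σ_companionFun, σ_companionFun, σ_companionFun, add_comm, R.U_add, star_mul]
    simp only [mul_assoc])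

lemma σ_companion (x : PosCone Γ) (a : A) :
    R.σ (R.companion x a) = star (R.U x) * R.σ a * R.U x := R.σ_companionFun x a

lemma commute_of_mul (x y : PosCone Γ) :
    star (R.U y) * R.U y * (R.U x * star (R.U x)) =
      R.U x * star (R.U x) * (star (R.U y) * R.U y) := by
  set p := star (R.U y) * R.U y with hp
  set q := R.U x * star (R.U x) with hq
  have hpp : p * p = p := by rw [hp, ← mul_assoc, R.partialIsometry_star]
  have hqq : q * q = q := by rw [hq, ← mul_assoc, R.partialIsometry]
  have hps : star p = p := by simp [hp]
  have hqs : star q = q := by simp [hq]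
  have hi : p * q * (p * q) = p * q := by
    have h1 := R.partialIsometry (y + x)
    rw [R.U_add, star_mul] at h1
    have h2 := congrArg (fun z => star (R.U y) * z * star (R.U x)) h1
    simp only [mul_assoc] at h2
    simp only [hp, hq, mul_assoc]
    exact h2
  have h0 : (p * q - p * q * p) * star (p * q - p * q * p) = 0 := by
    have e1 : p * q * p * q = p * q := by simpa only [mul_assoc] using hi
    simp only [star_sub, star_mul, hps, hqs, sub_mul, mul_sub, ← mul_assoc]
    simp [e1, mul_assoc p q q, mul_assoc _ p p, hqq, hpp]
  have h1 : p * q = p * q * p := sub_eq_zero.1 ((CStarRing.mul_star_self_eq_zero_iff _).1 h0)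
  have h2 := congrArg star h1
  simp only [star_mul, hps, hqs] at h2
  rw [h1, h2, mul_assoc]

/-- A finely representable action has a unique companion `H` making `(V, H)` a complete
interaction. -/
theorem existsUnique_isCompleteInteraction (R : CovariantRep V C) :
    ∃! H : Action Γ A, IsCompleteInteraction V H := by
  have hp := R.partialIsometry
  have hp' := R.partialIsometry_star
  have q : ∀ (x) (c : C), R.U x * (star (R.U x) * (R.U x * c)) = R.U x * c := fun x c => by
    conv_rhs => rw [← hp x]
    simp only [mul_assoc]
  have q' : ∀ (x) (c : C), star (R.U x) * (R.U x * (star (R.U x) * c)) = star (R.U x) * c :=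
    fun x c => by
      conv_rhs => rw [← hp' x]
      simp only [mul_assoc]
  have r : ∀ x, R.U x * (star (R.U x) * R.U x) = R.U x := fun x => by rw [← mul_assoc, hp]
  have r' : ∀ x, star (R.U x) * (R.U x * star (R.U x)) = star (R.U x) :=
    fun x => by rw [← mul_assoc, hp']
  refine ⟨R.companion, ?_, ?_⟩
  · constructor
    · constructor
      · intro x a; apply R.injective
        simp only [R.map_action, σ_companion, mul_assoc, q, r']
      · intro x a; apply R.injective
        simp only [R.map_action, σ_companion, mul_assoc, q', r]
      · rintro x a b (⟨c, rfl⟩ | ⟨c, rfl⟩) <;> apply R.injective <;>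
          simp only [R.map_action, σ_companion, map_mul, mul_assoc, q, q']
      · rintro x a b (⟨c, rfl⟩ | ⟨c, rfl⟩) <;> apply R.injective <;>
          simp only [R.map_action, σ_companion, map_mul, mul_assoc, q, q']
    · intro x a; apply R.injective
      simp only [R.map_action, σ_companion, map_mul, map_one, mul_assoc, one_mul]
    · intro x a; apply R.injective
      simp only [R.map_action, σ_companion, map_mul, map_one, mul_assoc, one_mul]
    · intro x y; apply R.injective
      simp only [R.map_action, σ_companion, map_mul, map_one, mul_one]
      apply R.commute_of_mul
  · intro H h
    have : H.toFun = R.companion.toFun := by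
      funext x
      ext a
      apply R.injective
      rw [σ_companion, R.map_companion h]
    cases H; cases hR : R.companion
    simp_all

end CovariantRep

end Existence

/-! ### The universal C⋆-algebra -/

/-- Generators of the crossed product: the elements of `A`, the `Û_x` and the `Û_x⋆`. -/
inductive Gen (Γ : Type v) [AddCommGroup Γ] [LinearOrder Γ] (A : Type u) : Type (max u v)
  | alg (a : A)
  | iso (x : PosCone Γ)
  | isoStar (x : PosCone Γ)

/-- The involution on generators. -/
def Gen.adj : Gen Γ A → Gen Γ A
  | alg a => alg (star a)
  | iso x => isoStar x
  | isoStar x => iso x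

lemma Gen.adj_adj (g : Gen Γ A) : g.adj.adj = g := by
  cases g <;> simp [Gen.adj]

/-- The adjoint of a word: reverse the word and take adjoints of the letters. -/
def wordAdj (l : FreeMonoid (Gen Γ A)) : FreeMonoid (Gen Γ A) :=
  FreeMonoid.ofList ((FreeMonoid.toList l).map Gen.adj).reverse

lemma wordAdj_one : wordAdj (1 : FreeMonoid (Gen Γ A)) = 1 := rfl

lemma wordAdj_mul (l m : FreeMonoid (Gen Γ A)) : wordAdj (l * m) = wordAdj m * wordAdj l := by
  simp [wordAdj]

lemma wordAdj_wordAdj (l : FreeMonoid (Gen Γ A)) : wordAdj (wordAdj l) = l := by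
  simp [wordAdj, Function.comp_def, Gen.adj_adj, List.map_reverse]

/-- The free unital ⋆-algebra over `ℂ` on the generators; the actions are recorded since the
seminorm below depends on them. -/
def Pre (_V _H : Action Γ A) : Type (max u v) := MonoidAlgebra ℂ (FreeMonoid (Gen Γ A))

namespace Pre

variable (V H : Action Γ A)

instance : Ring (Pre V H) := inferInstanceAs (Ring (MonoidAlgebra ℂ (FreeMonoid (Gen Γ A))))
instance : Algebra ℂ (Pre V H) :=
  inferInstanceAs (Algebra ℂ (MonoidAlgebra ℂ (FreeMonoid (Gen Γ A))))

variable {V H}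

/-- The word `l` with coefficient `c`. -/
def word (l : FreeMonoid (Gen Γ A)) (c : ℂ) : Pre V H := MonoidAlgebra.single l c

lemma word_mul (l m : FreeMonoid (Gen Γ A)) (c d : ℂ) :
    (word l c * word m d : Pre V H) = word (l * m) (c * d) :=
  MonoidAlgebra.single_mul_single ..

lemma one_eq : (1 : Pre V H) = word 1 1 := rfl

lemma smul_word (r : ℂ) (l : FreeMonoid (Gen Γ A)) (c : ℂ) :
    (r • word l c : Pre V H) = word l (r * c) := by
  exact MonoidAlgebra.smul_single ..

lemma induction {motive : Pre V H → Prop} (f : Pre V H)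
    (h1 : ∀ l c, motive (word l c)) (h2 : ∀ f g, motive f → motive g → motive (f + g)) :
    motive f := by
  have : ∀ x : MonoidAlgebra ℂ (FreeMonoid (Gen Γ A)),
      motive x ∧ ∀ r : ℂ, motive (r • x : MonoidAlgebra ℂ (FreeMonoid (Gen Γ A))) := by
    intro x
    induction x using MonoidAlgebra.induction_on with
    | of m => exact ⟨h1 m 1, fun r => by
        have := h1 m (r * 1); rw [← smul_word] at this; exact this⟩
    | add x y hx hy => exact ⟨h2 _ _ hx.1 hy.1, fun r => by
        rw [smul_add]; exact h2 _ _ (hx.2 r) (hy.2 r)⟩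
    | smul r x hx => exact ⟨hx.2 r, fun s => by rw [smul_smul]; exact hx.2 _⟩
  exact (this f).1

/-- The adjoint, as an additive map: `∑ c_l l ↦ ∑ conj(c_l) l⋆`. -/
def adj : Pre V H →+ Pre V H :=
  MonoidAlgebra.liftNC (R := Pre V H)
    ((algebraMap ℂ (Pre V H)).comp (starRingEnd ℂ) : ℂ →+* Pre V H).toAddMonoidHom
    (fun l => word (wordAdj l) 1)

lemma adj_word (l : FreeMonoid (Gen Γ A)) (c : ℂ) :
    adj (word l c : Pre V H) = word (wordAdj l) (starRingEnd ℂ c) := by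
  have : adj (word l c : Pre V H) =
      (algebraMap ℂ (Pre V H)) (starRingEnd ℂ c) * word (wordAdj l) 1 :=
    MonoidAlgebra.liftNC_single ..
  rw [this, ← Algebra.smul_def, smul_word, mul_one]

instance : StarRing (Pre V H) where
  star := adj
  star_involutive f := by
    change adj (adj f) = f
    induction f using Pre.induction with
    | h1 l c => simp [adj_word, wordAdj_wordAdj]
    | h2 f g hf hg => rw [map_add, map_add, hf, hg]
  star_mul f g := by
    change adj (f * g) = adj g * adj f
    induction f using Pre.induction with
    | h1 l c =>
      induction g using Pre.induction with
      | h1 m d => simp [adj_word, word_mul, wordAdj_mul, mul_comm]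
      | h2 f g hf hg => rw [mul_add, map_add, map_add, hf, hg, add_mul]
    | h2 f f' hf hg => rw [add_mul, map_add, map_add, hf, hg, mul_add]
  star_add := map_add adj

lemma star_word (l : FreeMonoid (Gen Γ A)) (c : ℂ) :
    star (word l c : Pre V H) = word (wordAdj l) (starRingEnd ℂ c) := adj_word l c

instance : StarModule ℂ (Pre V H) where
  star_smul r f := by
    induction f using Pre.induction with
    | h1 l c => simp [smul_word, star_word]
    | h2 f g hf hg => rw [smul_add, star_add, hf, hg, star_add, smul_add]

/-- The generator `a ∈ A`. -/
def ofAlg (a : A) : Pre V H := word (FreeMonoid.of (Gen.alg a)) 1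

/-- The generator `Û_x`. -/
def iso (x : PosCone Γ) : Pre V H := word (FreeMonoid.of (Gen.iso x)) 1

lemma star_ofAlg (a : A) : star (ofAlg a : Pre V H) = ofAlg (star a) := by
  rw [ofAlg, star_word, map_one]; rfl

lemma star_iso (x : PosCone Γ) :
    star (iso x : Pre V H) = word (FreeMonoid.of (Gen.isoStar x)) 1 := by
  rw [iso, star_word, map_one]; rfl

/-- The defining relations of the crossed product, as pairs of elements to be identified:
`A` sits inside as a unital algebra (compatibility with `⋆` is built in), the `Û_x`
are partial isometries with `Û_x Û_y = Û_{x+y}`, and they implement `V` and `H`. -/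
inductive Rel : Pre V H → Pre V H → Prop
  | add (a b : A) : Rel (ofAlg (a + b)) (ofAlg a + ofAlg b)
  | smul (c : ℂ) (a : A) : Rel (ofAlg (c • a)) (c • ofAlg a)
  | mul (a b : A) : Rel (ofAlg (a * b)) (ofAlg a * ofAlg b)
  | one : Rel (ofAlg 1) 1
  | iso_add (x y : PosCone Γ) : Rel (iso (x + y)) (iso x * iso y)
  | partialIsometry (x : PosCone Γ) : Rel (iso x * star (iso x) * iso x) (iso x)
  | left (x : PosCone Γ) (a : A) : Rel (ofAlg (V x a)) (iso x * ofAlg a * star (iso x))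
  | right (x : PosCone Γ) (a : A) : Rel (ofAlg (H x a)) (star (iso x) * ofAlg a * iso x)

/-- A C⋆-seminorm on the free ⋆-algebra that respects the defining relations. The bound on `A` is
automatic (⋆-homomorphisms between C⋆-algebras are contractive), so these are exactly the seminorms
`f ↦ ‖π f‖` for `π` a ⋆-representation of the relations in a C⋆-algebra. -/
structure IsAdmissible (p : Seminorm ℂ (Pre V H)) : Prop where
  mul_le : ∀ f g, p (f * g) ≤ p f * p g
  star_mul_self : ∀ f, p (star f * f) = p f ^ 2
  rel : ∀ f g, Rel f g → p (f - g) = 0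
  bound : ∀ a : A, p (ofAlg a) ≤ ‖a‖

namespace IsAdmissible

variable {p : Seminorm ℂ (Pre V H)}

lemma le_star (hp : IsAdmissible p) (f : Pre V H) : p f ≤ p (star f) := by
  have h := hp.star_mul_self f
  have h2 := hp.mul_le (star f) f
  have h0 := apply_nonneg p f
  rcases h0.eq_or_lt with h0 | h0
  · rw [← h0]; exact apply_nonneg p _
  · nlinarith

lemma star_eq (hp : IsAdmissible p) (f : Pre V H) : p (star f) = p f :=
  le_antisymm (by simpa using hp.le_star (star f)) (hp.le_star f)

lemma one_le (hp : IsAdmissible p) : p 1 ≤ 1 := by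
  have h := hp.star_mul_self 1
  rw [star_one, one_mul] at h
  have h0 := apply_nonneg p (1 : Pre V H)
  nlinarith

lemma eq_of_rel {f g : Pre V H} (h : p (f - g) = 0) : p f = p g := by
  have := abs_sub_map_le_sub p f g
  rw [h] at this
  exact sub_eq_zero.1 (abs_nonpos_iff.1 this)

lemma iso_le (hp : IsAdmissible p) (x : PosCone Γ) : p (iso x) ≤ 1 := by
  set e : Pre V H := star (iso x) * iso x with he
  have h1 : p (e * e) = p e := by
    refine eq_of_rel (le_antisymm ?_ (apply_nonneg _ _))
    have : e * e - e = star (iso x) * (iso x * star (iso x) * iso x - iso x) := by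
      rw [he]; noncomm_ring
    rw [this]
    refine (hp.mul_le _ _).trans ?_
    rw [hp.rel _ _ (Rel.partialIsometry x), mul_zero]
  have h2 : p (e * e) = p e ^ 2 := by
    have := hp.star_mul_self e
    rwa [he, star_mul, star_star, ← he] at this
  have h3 : p e = p (iso x) ^ 2 := hp.star_mul_self _
  have h4 := apply_nonneg p (iso x)
  have h5 := apply_nonneg p e
  have h6 : p e ≤ 1 := by nlinarith
  nlinarith

end IsAdmissible

/-- A bound, uniform over the admissible seminorms, for the size of a generator. -/
def genBound : Gen Γ A → ℝ
  | .alg a => ‖a‖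
  | .iso _ => 1
  | .isoStar _ => 1

lemma IsAdmissible.gen_le {p : Seminorm ℂ (Pre V H)} (hp : IsAdmissible p) (g : Gen Γ A) :
    p (word (FreeMonoid.of g) 1) ≤ genBound g := by
  cases g with
  | alg a => exact hp.bound a
  | iso x => exact hp.iso_le x
  | isoStar x =>
    have := hp.star_eq (iso x)
    rw [star_iso] at this
    rw [this]
    exact hp.iso_le x

lemma exists_bound (f : Pre V H) :
    ∃ B : ℝ, ∀ p : Seminorm ℂ (Pre V H), IsAdmissible p → p f ≤ B := by
  induction f using Pre.induction with
  | h1 l c =>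
    have key : ∃ B : ℝ, ∀ p : Seminorm ℂ (Pre V H), IsAdmissible p → p (word l 1) ≤ B := by
      induction l using FreeMonoid.recOn with
      | one => exact ⟨1, fun p hp => hp.one_le⟩
      | of_mul g l ih =>
        obtain ⟨B, hB⟩ := ih
        refine ⟨genBound g * B, fun p hp => ?_⟩
        have : (word (FreeMonoid.of g * l) 1 : Pre V H) = word (FreeMonoid.of g) 1 * word l 1 := by
          rw [word_mul, one_mul]
        rw [this]
        refine (hp.mul_le _ _).trans ?_
        exact mul_le_mul (hp.gen_le g) (hB p hp) (apply_nonneg _ _)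
          ((apply_nonneg p _).trans (hp.gen_le g))
    obtain ⟨B, hB⟩ := key
    refine ⟨‖c‖ * B, fun p hp => ?_⟩
    have : (word l c : Pre V H) = c • word l 1 := by rw [smul_word, mul_one]
    rw [this, map_smul_eq_mul]
    exact mul_le_mul_of_nonneg_left (hB p hp) (norm_nonneg _)
  | h2 f g hf hg =>
    obtain ⟨B, hB⟩ := hf
    obtain ⟨B', hB'⟩ := hg
    exact ⟨B + B', fun p hp => (map_add_le_add p f g).trans (add_le_add (hB p hp) (hB' p hp))⟩

lemma isAdmissible_zero : IsAdmissible (0 : Seminorm ℂ (Pre V H)) where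
  mul_le := by simp
  star_mul_self := by simp
  rel := by simp
  bound := by simp

instance : Nonempty {p : Seminorm ℂ (Pre V H) // IsAdmissible p} := ⟨⟨0, isAdmissible_zero⟩⟩

/-- The universal C⋆-seminorm: the supremum of all admissible ones (a finite supremum by
`exists_bound`). -/
def unorm (f : Pre V H) : ℝ := ⨆ p : {p : Seminorm ℂ (Pre V H) // IsAdmissible p}, p.1 f

lemma bddAbove (f : Pre V H) :
    BddAbove (Set.range fun p : {p : Seminorm ℂ (Pre V H) // IsAdmissible p} => p.1 f) := by
  obtain ⟨B, hB⟩ := exists_bound f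
  exact ⟨B, by rintro _ ⟨p, rfl⟩; exact hB p.1 p.2⟩

lemma le_unorm {p : Seminorm ℂ (Pre V H)} (hp : IsAdmissible p) (f : Pre V H) : p f ≤ unorm f :=
  le_ciSup (bddAbove f) (⟨p, hp⟩ : {p : Seminorm ℂ (Pre V H) // IsAdmissible p})

lemma unorm_le {f : Pre V H} {B : ℝ}
    (h : ∀ p : Seminorm ℂ (Pre V H), IsAdmissible p → p f ≤ B) : unorm f ≤ B :=
  ciSup_le fun p => h p.1 p.2

lemma unorm_nonneg (f : Pre V H) : 0 ≤ unorm f := by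
  simpa using le_unorm isAdmissible_zero f

lemma unorm_mul_le (f g : Pre V H) : unorm (f * g) ≤ unorm f * unorm g :=
  unorm_le fun _ hp => (hp.mul_le f g).trans
    (mul_le_mul (le_unorm hp f) (le_unorm hp g) (apply_nonneg _ _) (unorm_nonneg f))

lemma unorm_smul_le (c : ℂ) (f : Pre V H) : unorm (c • f) ≤ ‖c‖ * unorm f :=
  unorm_le fun p hp => by
    rw [map_smul_eq_mul]
    exact mul_le_mul_of_nonneg_left (le_unorm hp f) (norm_nonneg _)

lemma unorm_star (f : Pre V H) : unorm (star f) = unorm f := by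
  apply le_antisymm
  · exact unorm_le fun p hp => (hp.star_eq f).le.trans (le_unorm hp f)
  · exact unorm_le fun p hp => (hp.star_eq f).ge.trans (le_unorm hp (star f))

lemma unorm_sq_le (f : Pre V H) : unorm f * unorm f ≤ unorm (star f * f) := by
  have : unorm f ≤ Real.sqrt (unorm (star f * f)) := unorm_le fun p hp => by
    apply Real.le_sqrt_of_sq_le
    rw [← hp.star_mul_self]
    exact le_unorm hp _
  calc unorm f * unorm f ≤ Real.sqrt (unorm (star f * f)) * Real.sqrt (unorm (star f * f)) :=
        mul_self_le_mul_self (unorm_nonneg f) this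
    _ = _ := Real.mul_self_sqrt (unorm_nonneg _)

/-- The universal C⋆-seminorm, bundled. -/
def uRingSeminorm (V H : Action Γ A) : RingSeminorm (Pre V H) where
  toFun := unorm
  map_zero' := le_antisymm (unorm_le fun q _ => (map_zero q).le) (unorm_nonneg 0)
  add_le' f g := unorm_le fun q hp => (map_add_le_add q f g).trans
    (add_le_add (le_unorm hp f) (le_unorm hp g))
  neg' f := by
    have : ∀ f : Pre V H, unorm (-f) ≤ unorm f := fun f => by
      have := unorm_smul_le (-1 : ℂ) f
      simpa using this
    exact le_antisymm (this f) (by simpa using this (-f))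
  mul_le' := unorm_mul_le

instance : SeminormedRing (Pre V H) := (uRingSeminorm V H).toSeminormedRing

lemma norm_def (f : Pre V H) : ‖f‖ = unorm f := rfl

instance : NormedAlgebra ℂ (Pre V H) where
  norm_smul_le := unorm_smul_le

instance : NormedStarGroup (Pre V H) where
  norm_star_le f := (unorm_star f).le

end Pre

open UniformSpace in
/-- The crossed product `A ⋊_{(V,H)} Γ`: the universal unital C⋆-algebra generated by a copy of `A`
and partial isometries `Û_x` subject to `Pre.Rel`, i.e. the Hausdorff completion of the free
⋆-algebra in the universal C⋆-seminorm. -/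
def CrossedProduct (V H : Action Γ A) : Type (max u v) := Completion (Pre V H)

namespace CrossedProduct

open UniformSpace

variable {V H : Action Γ A}

instance : NormedRing (CrossedProduct V H) := inferInstanceAs (NormedRing (Completion (Pre V H)))
instance : CompleteSpace (CrossedProduct V H) :=
  inferInstanceAs (CompleteSpace (Completion (Pre V H)))
instance : NormedAlgebra ℂ (CrossedProduct V H) where
  __ := (inferInstance : Algebra ℂ (Completion (Pre V H)))
  norm_smul_le := (inferInstance : NormedSpace ℂ (Completion (Pre V H))).norm_smul_le

/-- The canonical map from the free ⋆-algebra. -/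
def mk (f : Pre V H) : CrossedProduct V H := (f : Completion (Pre V H))

lemma mk_add (f g : Pre V H) : mk (f + g) = mk f + mk g := Completion.coe_add f g
lemma mk_mul (f g : Pre V H) : mk (f * g) = mk f * mk g := Completion.coe_mul f g
lemma mk_sub (f g : Pre V H) : mk (f - g) = mk f - mk g := Completion.coe_sub f g
lemma mk_one : mk (1 : Pre V H) = 1 := Completion.coe_one _
lemma mk_smul (c : ℂ) (f : Pre V H) : mk (c • f) = c • mk f := Completion.coe_smul c f
lemma mk_algebraMap (c : ℂ) :
    mk (algebraMap ℂ (Pre V H) c) = algebraMap ℂ (CrossedProduct V H) c := rfl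
lemma norm_mk (f : Pre V H) : ‖mk f‖ = ‖f‖ := Completion.norm_coe f
lemma continuous_mk : Continuous (mk : Pre V H → CrossedProduct V H) := Completion.continuous_coe _
lemma denseRange_mk : DenseRange (mk : Pre V H → CrossedProduct V H) := Completion.denseRange_coe

lemma mk_eq_of_rel {f g : Pre V H} (h : Pre.Rel f g) : mk f = mk g := by
  rw [← sub_eq_zero, ← mk_sub, ← norm_eq_zero, norm_mk, Pre.norm_def]
  exact le_antisymm (Pre.unorm_le fun p hp => (hp.rel f g h).le) (Pre.unorm_nonneg _)

lemma induction {motive : CrossedProduct V H → Prop} (a : CrossedProduct V H)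
    (hc : IsClosed {a | motive a}) (h : ∀ f, motive (mk f)) : motive a :=
  Completion.induction_on a hc h

lemma induction₂ {motive : CrossedProduct V H → CrossedProduct V H → Prop}
    (a b : CrossedProduct V H)
    (hc : IsClosed {x : CrossedProduct V H × CrossedProduct V H | motive x.1 x.2})
    (h : ∀ f g, motive (mk f) (mk g)) : motive a b :=
  Completion.induction_on₂ a b hc h

/-- The involution of the crossed product, by continuous extension. -/
def adj : CrossedProduct V H → CrossedProduct V H :=
  Completion.map (star : Pre V H → Pre V H)

lemma continuous_adj : Continuous (adj : CrossedProduct V H → CrossedProduct V H) :=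
  Completion.continuous_map

lemma adj_mk (f : Pre V H) : adj (mk f) = mk (star f) :=
  Completion.map_coe (star_isometry (E := Pre V H)).uniformContinuous f

instance : StarRing (CrossedProduct V H) where
  star := adj
  star_involutive a := by
    change adj (adj a) = a
    induction a using CrossedProduct.induction with
    | hc =>
      exact isClosed_eq (continuous_adj.comp continuous_adj) continuous_id
    | h f => rw [adj_mk, adj_mk, star_star]
  star_mul a b := by
    change adj (a * b) = adj b * adj a
    induction a, b using CrossedProduct.induction₂ with
    | hc =>
      exact isClosed_eq (continuous_adj.comp continuous_mul)
        ((continuous_adj.comp continuous_snd).mul (continuous_adj.comp continuous_fst))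
    | h f g => simp only [← mk_mul, adj_mk, star_mul]
  star_add a b := by
    change adj (a + b) = adj a + adj b
    induction a, b using CrossedProduct.induction₂ with
    | hc =>
      exact isClosed_eq (continuous_adj.comp continuous_add)
        ((continuous_adj.comp continuous_fst).add (continuous_adj.comp continuous_snd))
    | h f g => simp only [← mk_add, adj_mk, star_add]

lemma star_mk (f : Pre V H) : star (mk f) = mk (star f) := adj_mk f

instance : StarModule ℂ (CrossedProduct V H) where
  star_smul c a := by
    change adj (c • a) = star c • adj a
    induction a using CrossedProduct.induction with
    | hc =>
      exact isClosed_eq (continuous_adj.comp (continuous_const_smul c))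
        ((continuous_const_smul (star c)).comp continuous_adj)
    | h f => simp only [← mk_smul, adj_mk, star_smul]

instance : CStarRing (CrossedProduct V H) where
  norm_mul_self_le a := by
    change ‖a‖ * ‖a‖ ≤ ‖adj a * a‖
    induction a using CrossedProduct.induction with
    | hc =>
      exact isClosed_le (continuous_norm.mul continuous_norm)
        (continuous_adj.mul continuous_id).norm
    | h f =>
      rw [adj_mk, ← mk_mul, norm_mk, norm_mk]
      exact Pre.unorm_sq_le f

instance : CStarAlgebra (CrossedProduct V H) where

/-- The copy of `A` in the crossed product, as a unital ⋆-homomorphism. -/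
def ι : A →⋆ₐ[ℂ] CrossedProduct V H where
  toFun a := mk (Pre.ofAlg a)
  map_one' := by rw [mk_eq_of_rel Pre.Rel.one, mk_one]
  map_mul' a b := by rw [mk_eq_of_rel (Pre.Rel.mul a b), mk_mul]
  map_zero' := by
    have := mk_eq_of_rel (Pre.Rel.smul (V := V) (H := H) 0 (0 : A))
    rw [mk_smul, zero_smul, zero_smul] at this
    exact this
  map_add' a b := by rw [mk_eq_of_rel (Pre.Rel.add a b), mk_add]
  commutes' c := by
    rw [Algebra.algebraMap_eq_smul_one, mk_eq_of_rel (Pre.Rel.smul c 1), mk_smul,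
      mk_eq_of_rel Pre.Rel.one, mk_one, Algebra.algebraMap_eq_smul_one]
  map_star' a := by rw [star_mk, Pre.star_ofAlg]

/-- The canonical partial isometry `Û_x` of the crossed product. -/
def Uhat (x : PosCone Γ) : CrossedProduct V H := mk (Pre.iso x)

/-- The ⋆-subalgebra `C₀` of the crossed product generated by `A` and the `Û_x`. -/
def C₀ (V H : Action Γ A) : StarSubalgebra ℂ (CrossedProduct V H) :=
  StarAlgebra.adjoin ℂ (Set.range ι ∪ Set.range Uhat)

/-- The degree `x₁ + ⋯ + xₙ` of a monomial. -/
def degree (l : List (A × PosCone Γ)) : PosCone Γ := (l.map Prod.snd).sum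

/-- The monomial `a₁ Û_{x₁} ⋯ aₙ Û_{xₙ}` of positive type. -/
def posMonomial (l : List (A × PosCone Γ)) : CrossedProduct V H :=
  (l.map fun p => ι p.1 * Uhat p.2).prod

/-- The monomial `a₁ Û_{x₁}⋆ ⋯ aₙ Û_{xₙ}⋆` of negative type. -/
def negMonomial (l : List (A × PosCone Γ)) : CrossedProduct V H :=
  (l.map fun p => ι p.1 * star (Uhat p.2)).prod

/-- Quasi-monomials of positive type and degree `x`: finite sums of monomials of that type and
degree. -/
def posQuasiMonomials (V H : Action Γ A) (x : PosCone Γ) : AddSubmonoid (CrossedProduct V H) :=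
  AddSubmonoid.closure {q | ∃ l : List (A × PosCone Γ), degree l = x ∧ posMonomial l = q}

/-- Quasi-monomials of negative type and degree `x`. -/
def negQuasiMonomials (V H : Action Γ A) (x : PosCone Γ) : AddSubmonoid (CrossedProduct V H) :=
  AddSubmonoid.closure {q | ∃ l : List (A × PosCone Γ), degree l = x ∧ negMonomial l = q}

/-- `IsE₀ a a₀`: the element `a` has a presentation `a = ∑_{x ∈ F} q_{-x} + a₀ + ∑_{x ∈ F} q_x`
with `F ⊂ Γ⁺ ∖ {0}` finite, quasi-monomials `q_{±x}` of degree `x`, and `a₀ ∈ A`. This is the graph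
of the map `E₀ : C₀ → A`, `E₀(a) = a₀`. -/
def IsE₀ (a : CrossedProduct V H) (a₀ : A) : Prop :=
  ∃ (F : Finset (PosCone Γ)) (qneg qpos : PosCone Γ → CrossedProduct V H),
    (∀ x ∈ F, x ≠ 0 ∧ qneg x ∈ negQuasiMonomials V H x ∧ qpos x ∈ posQuasiMonomials V H x) ∧
    a = ∑ x ∈ F, qneg x + ι a₀ + ∑ x ∈ F, qpos x

end CrossedProduct

namespace CovariantRep

open CrossedProduct UniformSpace

variable {V H : Action Γ A} {C : Type w} [CStarAlgebra C] (R : CovariantRep V C)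

/-- The images of the generators in a covariant representation. -/
def onGen : Gen Γ A → C
  | .alg a => R.σ a
  | .iso x => R.U x
  | .isoStar x => star (R.U x)

/-- The representation of the free ⋆-algebra. -/
def onPre : Pre V H →ₐ[ℂ] C :=
  MonoidAlgebra.lift ℂ C (FreeMonoid (Gen Γ A)) (FreeMonoid.lift R.onGen)

lemma onPre_word (l : FreeMonoid (Gen Γ A)) (c : ℂ) :
    R.onPre (Pre.word l c : Pre V H) = c • FreeMonoid.lift R.onGen l :=
  MonoidAlgebra.lift_single ..

lemma onPre_ofAlg (a : A) : R.onPre (Pre.ofAlg a : Pre V H) = R.σ a := by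
  rw [Pre.ofAlg, onPre_word, one_smul, FreeMonoid.lift_eval_of]; rfl

lemma onPre_iso (x : PosCone Γ) : R.onPre (Pre.iso x : Pre V H) = R.U x := by
  rw [Pre.iso, onPre_word, one_smul, FreeMonoid.lift_eval_of]; rfl

lemma onGen_adj (g : Gen Γ A) : R.onGen g.adj = star (R.onGen g) := by
  cases g <;> simp [onGen, Gen.adj, map_star]

lemma lift_wordAdj (l : FreeMonoid (Gen Γ A)) :
    FreeMonoid.lift R.onGen (wordAdj l) = star (FreeMonoid.lift R.onGen l) := by
  induction l using FreeMonoid.recOn with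
  | one => simp [wordAdj_one]
  | of_mul g l ih =>
    rw [wordAdj_mul, map_mul, ih, map_mul, star_mul]
    congr 1
    rw [FreeMonoid.lift_eval_of, ← onGen_adj]
    exact FreeMonoid.lift_eval_of _ _

lemma onPre_star (f : Pre V H) : R.onPre (star f) = star (R.onPre f) := by
  induction f using Pre.induction with
  | h1 l c => rw [Pre.star_word, onPre_word, onPre_word, lift_wordAdj, star_smul]; rfl
  | h2 f g hf hg => rw [star_add, map_add, hf, hg, map_add, star_add]

lemma onPre_rel (h : IsCompleteInteraction V H) {f g : Pre V H} (hr : Pre.Rel f g) :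
    R.onPre f = R.onPre g := by
  cases hr with
  | add a b => simp [onPre_ofAlg]
  | smul c a => simp [onPre_ofAlg]
  | mul a b => simp [onPre_ofAlg]
  | one => simp [onPre_ofAlg]
  | iso_add x y => simp [onPre_iso, R.U_add]
  | partialIsometry x => simp [onPre_iso, onPre_star, R.partialIsometry]
  | left x a => simp [onPre_iso, onPre_ofAlg, onPre_star, R.map_action]
  | right x a => simp [onPre_iso, onPre_ofAlg, onPre_star, R.map_companion h]

lemma isAdmissible (h : IsCompleteInteraction V H) :
    Pre.IsAdmissible ((normSeminorm ℂ C).comp (R.onPre (H := H)).toLinearMap) where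
  mul_le f g := by simpa using norm_mul_le (R.onPre f) (R.onPre g)
  star_mul_self f := by
    simp [onPre_star, CStarRing.norm_star_mul_self, sq]
  rel f g hr := by simp [R.onPre_rel h hr]
  bound a := by simpa [onPre_ofAlg] using NonUnitalStarAlgHom.norm_apply_le R.σ a

lemma norm_onPre_le (h : IsCompleteInteraction V H) (f : Pre V H) : ‖R.onPre f‖ ≤ ‖f‖ :=
  Pre.le_unorm (R.isAdmissible h) f

lemma continuous_onPre (h : IsCompleteInteraction V H) :
    Continuous (R.onPre (H := H) : Pre V H →+* C) :=
  AddMonoidHomClass.continuous_of_bound (R.onPre (H := H) : Pre V H →+* C) 1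
    fun f => by simpa using R.norm_onPre_le h f

/-- The ring homomorphism underlying `σ × U`. -/
def integratedRingHom (h : IsCompleteInteraction V H) : CrossedProduct V H →+* C :=
  Completion.extensionHom (R.onPre (H := H) : Pre V H →+* C) (R.continuous_onPre h)

lemma integratedRingHom_mk (h : IsCompleteInteraction V H) (f : Pre V H) :
    R.integratedRingHom h (CrossedProduct.mk f) = R.onPre f :=
  Completion.extensionHom_coe _ (R.continuous_onPre h) f

lemma continuous_integratedRingHom (h : IsCompleteInteraction V H) :
    Continuous (R.integratedRingHom h) :=
  Completion.continuous_extension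

/-- The homomorphism `σ × U` from the crossed product to `C`. -/
def integrated (h : IsCompleteInteraction V H) : CrossedProduct V H →⋆ₐ[ℂ] C where
  __ := R.integratedRingHom h
  commutes' c := by
    change R.integratedRingHom h (algebraMap ℂ _ c) = _
    rw [← mk_algebraMap, integratedRingHom_mk, AlgHom.commutes]
  map_star' a := by
    change R.integratedRingHom h (star a) = star (R.integratedRingHom h a)
    induction a using CrossedProduct.induction with
    | hc =>
      exact isClosed_eq ((R.continuous_integratedRingHom h).comp continuous_star)
        (R.continuous_integratedRingHom h).star
    | h f => rw [star_mk, integratedRingHom_mk, integratedRingHom_mk, onPre_star]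

@[simp] lemma integrated_ι (h : IsCompleteInteraction V H) (a : A) :
    R.integrated h (ι a) = R.σ a :=
  (R.integratedRingHom_mk h _).trans (R.onPre_ofAlg a)

@[simp] lemma integrated_Uhat (h : IsCompleteInteraction V H) (x : PosCone Γ) :
    R.integrated h (Uhat x) = R.U x :=
  (R.integratedRingHom_mk h _).trans (R.onPre_iso x)

/-- Property (*): `‖E₀(a)‖ ≤ ‖(σ × U)(a)‖` for every `a ∈ C₀`. -/
def PropertyStar (h : IsCompleteInteraction V H) : Prop :=
  ∀ a ∈ C₀ V H, ∀ a₀ : A, IsE₀ a a₀ → ‖a₀‖ ≤ ‖R.integrated h a‖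

end CovariantRep

end Actions

end SemigroupInteraction

end

namespace SemigroupInteraction

universe u v w

namespace CrossedProduct

variable {Γ : Type v} [AddCommGroup Γ] [LinearOrder Γ] [IsOrderedAddMonoid Γ]
variable {A : Type u} [CStarAlgebra A] [PartialOrder A] [StarOrderedRing A]
variable {V H : Action Γ A}

/-! ### Relations between the generators of the crossed product -/

/-! The crossed product behaves like an algebra graded by `Γ`, and property (*) says that the
projection onto degree zero can be controlled inside `C`.

If `σ × U` is injective, it is isometric, so what has to be shown is that `E₀` is contractive on the
crossed product itself. A character `u` of `Γ` gives a gauge endomorphism fixing `A` and sending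
`Û_x` to `u(x) Û_x`. Averaging over the powers of `u` is a contraction fixing `A`, and it kills the
degrees `±x` when `u(x)` is a nontrivial root of unity of the right order. Removing the finitely
many nonzero degrees of a presentation one at a time leaves `a₀` (`norm_ι_le_of_eigen`,
`norm_le_of_isE₀`). Both implications treat `E₀` as a relation, so that its independence of the
presentation is never needed.

Conversely, assume (*). Because `Γ` is totally ordered, every product of generators collapses to a
monomial of one type (`mul_prod_collapse`), so a dense set of elements `b` are finite sums of
homogeneous components `d_g`, with `g` in a finite set `S`. The degree-zero part of `b b⋆` is `∑ d_g
d_g⋆`, a sum of positive elements of `A`. Hence (*) bounds every `‖d_g‖` by `‖(σ × U)(b)‖`, and `‖b‖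
≤ |S| ‖(σ × U)(b)‖` (`PropertyStar.norm_le_card_mul`). The factor `|S|` is removed by passing to
powers: for self-adjoint `b`, `‖b ^ 2ⁿ‖ = ‖b‖ ^ 2ⁿ`, while the support of `b ^ k` grows only
polynomially in `k`, `Γ` being abelian (`exists_growth`, `le_of_pow_le_mul_pow`). The C⋆-identity
and density then make `σ × U` bounded below by the norm. -/

lemma Uhat_add (x y : PosCone Γ) : (Uhat (x + y) : CrossedProduct V H) = Uhat x * Uhat y := by
  rw [Uhat, mk_eq_of_rel (Pre.Rel.iso_add x y), mk_mul]; rfl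

lemma Uhat_mul_star_mul (x : PosCone Γ) :
    (Uhat x * star (Uhat x) * Uhat x : CrossedProduct V H) = Uhat x := by
  have := mk_eq_of_rel (Pre.Rel.partialIsometry (V := V) (H := H) x)
  rwa [mk_mul, mk_mul, ← star_mk] at this

lemma ι_left (x : PosCone Γ) (a : A) :
    (ι (V x a) : CrossedProduct V H) = Uhat x * ι a * star (Uhat x) := by
  have := mk_eq_of_rel (Pre.Rel.left (V := V) (H := H) x a)
  rwa [mk_mul, mk_mul, ← star_mk] at this

lemma ι_right (x : PosCone Γ) (a : A) :
    (ι (H x a) : CrossedProduct V H) = star (Uhat x) * ι a * Uhat x := by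
  have := mk_eq_of_rel (Pre.Rel.right (V := V) (H := H) x a)
  rwa [mk_mul, mk_mul, ← star_mk] at this

/-- This is not among the defining relations. It follows since `V_0 = Id` makes `Û_0 Û_0⋆ = 1`, and
an idempotent with a right inverse is `1`. -/
lemma Uhat_zero : (Uhat 0 : CrossedProduct V H) = 1 := by
  have h1 : (Uhat 0 * star (Uhat 0) : CrossedProduct V H) = 1 := by
    have := ι_left (V := V) (H := H) 0 1
    rw [V.map_zero', map_one, mul_one] at this
    exact this.symm
  have h2 : (Uhat 0 * Uhat 0 : CrossedProduct V H) = Uhat 0 := by rw [← Uhat_add, add_zero]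
  calc (Uhat 0 : CrossedProduct V H) = Uhat 0 * (Uhat 0 * star (Uhat 0)) := by rw [h1, mul_one]
    _ = 1 := by rw [← mul_assoc, h2, h1]

/-! ### Monomials -/

lemma degree_cons (p : A × PosCone Γ) (l : List (A × PosCone Γ)) :
    degree (p :: l) = p.2 + degree l := by
  simp [degree]

lemma posMonomial_cons (p : A × PosCone Γ) (l : List (A × PosCone Γ)) :
    (posMonomial (p :: l) : CrossedProduct V H) = ι p.1 * Uhat p.2 * posMonomial l := by
  simp [posMonomial]

lemma negMonomial_cons (p : A × PosCone Γ) (l : List (A × PosCone Γ)) :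
    (negMonomial (p :: l) : CrossedProduct V H) = ι p.1 * star (Uhat p.2) * negMonomial l := by
  simp [negMonomial]

/-- In an algebra in which two semigroups `U`, `W` satisfy `U_y f(a) W_y = f(S_y a)`, a product
`U_x f(c) (f(a₁) W_{x₁} ⋯ f(aₙ) W_{xₙ})` collapses to a product of one of the two types. -/
lemma mul_prod_collapse {B : Type*} [Ring B] (f : A →+* B) (U W : PosCone Γ → B)
    (S : PosCone Γ → A → A) (hU : ∀ x y, U (x + y) = U x * U y) (hU0 : U 0 = 1)
    (hW : ∀ x y, W (x + y) = W x * W y) (hS : ∀ x a, U x * f a * W x = f (S x a))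
    (l : List (A × PosCone Γ)) (x : PosCone Γ) (c : A) :
    (∃ l' : List (A × PosCone Γ), degree l' + degree l = x ∧
      (l'.map fun p => f p.1 * U p.2).prod =
        U x * f c * (l.map fun p => f p.1 * W p.2).prod) ∨
    ∃ l' : List (A × PosCone Γ), degree l' + x = degree l ∧
      (l'.map fun p => f p.1 * W p.2).prod =
        U x * f c * (l.map fun p => f p.1 * W p.2).prod := by
  induction l generalizing x c with
  -- A monomial must end in a letter `U`, so the trailing coefficient `c` is followed by `U_0 = 1`.
  | nil => exact .inl ⟨[(1, x), (c, 0)], by simp [degree], by simp [hU0]⟩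
  | cons p l ih =>
    obtain ⟨a, y⟩ := p
    -- Totality of the order enters here. If `y = x + z`, then `U_x f(ca) W_x` is a coefficient and
    -- the remaining `W_z` heads a product of type `W`. If `x = z + y`, all of `W_y` is absorbed and
    -- the surviving `U_z` meets the shorter list.
    rcases le_total x y with hxy | hxy
    · obtain ⟨z, rfl⟩ : ∃ z : PosCone Γ, y = x + z :=
        ⟨⟨y.1 - x.1, sub_nonneg.2 hxy⟩, Subtype.ext (by simp)⟩
      refine .inr ⟨(S x (c * a), z) :: l, ?_, ?_⟩
      · simp only [degree, List.map_cons, List.sum_cons]; abel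
      · simp only [List.map_cons, List.prod_cons, ← hS, hW, map_mul, mul_assoc]
    · obtain ⟨z, rfl⟩ : ∃ z : PosCone Γ, x = z + y :=
        ⟨⟨x.1 - y.1, sub_nonneg.2 hxy⟩, Subtype.ext (by simp)⟩
      have hd : degree ((a, y) :: l) = y + degree l := by simp [degree]
      have hm : U z * f (S y (c * a)) * (l.map fun p => f p.1 * W p.2).prod =
          U (z + y) * f c * (((a, y) :: l).map fun p => f p.1 * W p.2).prod := by
        simp only [List.map_cons, List.prod_cons, ← hS, hU, map_mul, mul_assoc]
      rcases ih z (S y (c * a)) with ⟨l', h1, h2⟩ | ⟨l', h1, h2⟩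
      · exact .inl ⟨l', by rw [hd, ← h1]; abel, h2.trans hm⟩
      · exact .inr ⟨l', by rw [hd, ← h1]; abel, h2.trans hm⟩

/-- The monomials of degree `g ∈ Γ`: those of positive type and degree `g` if `0 ≤ g`, those of
negative type and degree `-g` if `g ≤ 0`. -/
noncomputable def monomials (V H : Action Γ A) (g : Γ) : Set (CrossedProduct V H) :=
  {b | (∃ l, (degree l : Γ) = g ∧ posMonomial l = b) ∨ ∃ l, (degree l : Γ) = -g ∧ negMonomial l = b}

lemma posMonomial_mem (l : List (A × PosCone Γ)) :
    (posMonomial l : CrossedProduct V H) ∈ monomials V H (degree l) := .inl ⟨l, rfl, rfl⟩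

lemma negMonomial_mem (l : List (A × PosCone Γ)) :
    (negMonomial l : CrossedProduct V H) ∈ monomials V H (-degree l) := .inr ⟨l, by simp, rfl⟩

lemma ι_mul_mem (a : A) {g : Γ} {b : CrossedProduct V H} (hb : b ∈ monomials V H g) :
    ι a * b ∈ monomials V H g := by
  rcases hb with ⟨l, h1, rfl⟩ | ⟨l, h1, rfl⟩
  · exact .inl ⟨(a, 0) :: l, by simpa [degree] using h1, by simp [posMonomial, Uhat_zero]⟩
  · exact .inr ⟨(a, 0) :: l, by simpa [degree] using h1, by simp [negMonomial, Uhat_zero]⟩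

/-- Only the negative type needs work: cancellation uses `Û_y a Û_y⋆ = V_y(a)`. The companion
statement for `Û_x⋆` is the mirror image, with `H` in place of `V`. -/
lemma Uhat_mul_mem (x : PosCone Γ) {g : Γ} {b : CrossedProduct V H} (hb : b ∈ monomials V H g) :
    Uhat x * b ∈ monomials V H (x + g) := by
  rcases hb with ⟨l, rfl, rfl⟩ | ⟨l, h1, rfl⟩
  · exact .inl ⟨(1, x) :: l, by simp [degree], by simp [posMonomial]⟩
  · rcases mul_prod_collapse (B := CrossedProduct V H) (ι : A →⋆ₐ[ℂ] _).toRingHom Uhat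
      (fun x => star (Uhat x)) (fun x => V x) Uhat_add Uhat_zero
      (fun x y => by rw [add_comm, Uhat_add, star_mul]) (fun x a => (ι_left x a).symm) l x 1 with
      ⟨l', h2, h3⟩ | ⟨l', h2, h3⟩
    · refine .inl ⟨l', ?_, by simpa [posMonomial, negMonomial] using h3⟩
      rw [← h2, Nonneg.coe_add, h1]; abel
    · refine .inr ⟨l', ?_, by simpa [posMonomial, negMonomial] using h3⟩
      have := congrArg Subtype.val h2
      rw [Nonneg.coe_add, h1] at this
      rw [neg_add, add_comm, ← this]; abel

lemma star_Uhat_mul_mem (x : PosCone Γ) {g : Γ} {b : CrossedProduct V H}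
    (hb : b ∈ monomials V H g) : star (Uhat x) * b ∈ monomials V H (-x + g) := by
  rcases hb with ⟨l, h1, rfl⟩ | ⟨l, h1, rfl⟩
  · rcases mul_prod_collapse (B := CrossedProduct V H) (ι : A →⋆ₐ[ℂ] _).toRingHom
      (fun x => star (Uhat x)) Uhat (fun x => H x)
      (fun x y => by rw [add_comm, Uhat_add, star_mul]) (by simp [Uhat_zero])
      Uhat_add (fun x a => (ι_right x a).symm) l x 1 with
      ⟨l', h2, h3⟩ | ⟨l', h2, h3⟩
    · refine .inr ⟨l', ?_, by simpa [posMonomial, negMonomial] using h3⟩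
      rw [← h2, Nonneg.coe_add, h1]; abel
    · refine .inl ⟨l', ?_, by simpa [posMonomial, negMonomial] using h3⟩
      have := congrArg Subtype.val h2
      rw [Nonneg.coe_add, h1] at this
      rw [← this]; abel
  · exact .inr ⟨(1, x) :: l, by rw [degree_cons, Nonneg.coe_add, h1]; abel, by simp [negMonomial]⟩

/-- The left factor is multiplied onto the right one letter by letter, starting from its last
letter. -/
lemma mul_mem_monomials {g h : Γ} {b c : CrossedProduct V H} (hb : b ∈ monomials V H g)
    (hc : c ∈ monomials V H h) : b * c ∈ monomials V H (g + h) := by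
  rcases hb with ⟨l, rfl, rfl⟩ | ⟨l, h1, rfl⟩
  · induction l with
    | nil => simpa [posMonomial, degree] using hc
    | cons p l ih =>
      have := ι_mul_mem p.1 (Uhat_mul_mem p.2 ih)
      simpa [posMonomial, degree, mul_assoc, add_assoc] using this
  · obtain rfl : g = -degree l := by rw [h1, neg_neg]
    clear h1
    induction l with
    | nil => simpa [negMonomial, degree] using hc
    | cons p l ih =>
      have := ι_mul_mem p.1 (star_Uhat_mul_mem p.2 ih)
      convert this using 1
      · congr 1; rw [degree_cons, Nonneg.coe_add]; abel
      · rw [negMonomial_cons, mul_assoc, mul_assoc]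

lemma ι_mem (a : A) : (ι a : CrossedProduct V H) ∈ monomials V H 0 := by
  simpa [posMonomial, degree, Uhat_zero] using posMonomial_mem (V := V) (H := H) [(a, (0 : PosCone Γ))]

lemma Uhat_mem (x : PosCone Γ) : (Uhat x : CrossedProduct V H) ∈ monomials V H x := by
  simpa [posMonomial, degree] using posMonomial_mem (V := V) (H := H) [((1 : A), x)]

lemma star_Uhat_mem (x : PosCone Γ) : (star (Uhat x) : CrossedProduct V H) ∈ monomials V H (-x) := by
  simpa [negMonomial, degree] using negMonomial_mem (V := V) (H := H) [((1 : A), x)]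

/-- The adjoint of `a Û_x` is `Û_x⋆ a⋆`, with the coefficient on the wrong side, so the reversed
word is put back in normal form by multiplying monomials. -/
lemma star_mem_monomials {g : Γ} {b : CrossedProduct V H} (hb : b ∈ monomials V H g) :
    star b ∈ monomials V H (-g) := by
  rcases hb with ⟨l, rfl, rfl⟩ | ⟨l, h1, rfl⟩
  · induction l with
    | nil => simpa [posMonomial, degree] using ι_mem (1 : A)
    | cons p l ih =>
      have := mul_mem_monomials ih (mul_mem_monomials (star_Uhat_mem p.2) (ι_mem (star p.1)))
      convert this using 1
      · congr 1; rw [degree_cons, Nonneg.coe_add]; abel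
      · simp [posMonomial_cons, map_star, mul_assoc]
  · obtain rfl : g = -degree l := by rw [h1, neg_neg]
    clear h1
    induction l with
    | nil => simpa [negMonomial, degree] using ι_mem (1 : A)
    | cons p l ih =>
      have := mul_mem_monomials ih (mul_mem_monomials (Uhat_mem p.2) (ι_mem (star p.1)))
      convert this using 1
      · congr 1; rw [degree_cons, Nonneg.coe_add]; abel
      · simp [negMonomial_cons, map_star, mul_assoc]

/-- A monomial of degree zero lies in the copy of `A`. -/
lemma exists_ι_eq {b : CrossedProduct V H} (hb : b ∈ monomials V H 0) : ∃ a : A, ι a = b := by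
  -- The degrees of the letters are nonnegative with sum zero, so all of them vanish and only
  -- coefficients remain.
  have key : ∀ l : List (A × PosCone Γ), degree l = 0 →
      ∀ p ∈ l, p.2 = 0 := by
    intro l hl p hp
    have : p.2 ≤ degree l :=
      List.single_le_sum (l := l.map Prod.snd) (fun x _ => x.2) _ (List.mem_map_of_mem hp)
    exact le_antisymm (hl ▸ this) p.2.2
  have hprod : ∀ l : List (A × PosCone Γ),
      (ι (l.map Prod.fst).prod : CrossedProduct V H) = (l.map fun p => ι p.1).prod := by
    intro l
    rw [map_list_prod, List.map_map]; rfl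
  rcases hb with ⟨l, h1, rfl⟩ | ⟨l, h1, rfl⟩
  · refine ⟨(l.map Prod.fst).prod, ?_⟩
    rw [hprod, posMonomial]
    congr 1
    refine List.map_congr_left fun p hp => ?_
    rw [key l (Subtype.ext h1) p hp, Uhat_zero, mul_one]
  · refine ⟨(l.map Prod.fst).prod, ?_⟩
    rw [hprod, negMonomial]
    congr 1
    refine List.map_congr_left fun p hp => ?_
    rw [key l (Subtype.ext (by simpa using h1)) p hp, Uhat_zero, star_one, mul_one]

lemma ι_mem_C₀ (a : A) : (ι a : CrossedProduct V H) ∈ C₀ V H :=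
  StarAlgebra.subset_adjoin ℂ _ (.inl ⟨a, rfl⟩)

lemma Uhat_mem_C₀ (x : PosCone Γ) : (Uhat x : CrossedProduct V H) ∈ C₀ V H :=
  StarAlgebra.subset_adjoin ℂ _ (.inr ⟨x, rfl⟩)

lemma monomials_subset_C₀ (g : Γ) : monomials V H g ⊆ C₀ V H := by
  rintro _ (⟨l, -, rfl⟩ | ⟨l, -, rfl⟩)
  · refine list_prod_mem fun b hb => ?_
    obtain ⟨p, -, rfl⟩ := List.mem_map.1 hb
    exact mul_mem (ι_mem_C₀ _) (Uhat_mem_C₀ _)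
  · refine list_prod_mem fun b hb => ?_
    obtain ⟨p, -, rfl⟩ := List.mem_map.1 hb
    exact mul_mem (ι_mem_C₀ _) (star_mem (Uhat_mem_C₀ _))

/-! ### Elements with finite support -/

/-- The finite sums of monomials of degree `g`. -/
noncomputable def homogeneous (V H : Action Γ A) (g : Γ) : Submodule ℕ (CrossedProduct V H) :=
  Submodule.span ℕ (monomials V H g)

/-- The finite sums of monomials with degrees in `S`. -/
noncomputable def supported (V H : Action Γ A) (S : Finset Γ) : Submodule ℕ (CrossedProduct V H) :=
  ⨆ g ∈ S, homogeneous V H g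

/-- Additive spans suffice because complex scalars can be absorbed in coefficients from `A`. Taking
them as `ℕ`-submodules gives access to products of spans, which reduces the claim to monomials. -/
lemma mul_mem_homogeneous {g h : Γ} {b c : CrossedProduct V H} (hb : b ∈ homogeneous V H g)
    (hc : c ∈ homogeneous V H h) : b * c ∈ homogeneous V H (g + h) := by
  have := Submodule.mul_mem_mul hb hc
  rw [homogeneous, homogeneous, Submodule.span_mul_span] at this
  refine Submodule.span_mono ?_ this
  rintro _ ⟨b, hb, c, hc, rfl⟩
  exact mul_mem_monomials hb hc

lemma star_mem_homogeneous {g : Γ} {b : CrossedProduct V H} (hb : b ∈ homogeneous V H g) :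
    star b ∈ homogeneous V H (-g) := by
  induction hb using Submodule.span_induction with
  | mem b hb => exact Submodule.subset_span (star_mem_monomials hb)
  | zero => simp
  | add b c _ _ hb hc => rw [star_add]; exact add_mem hb hc
  | smul n b _ hb => rw [star_nsmul]; exact nsmul_mem hb n

lemma exists_ι_eq_of_homogeneous {b : CrossedProduct V H} (hb : b ∈ homogeneous V H 0) :
    ∃ a : A, ι a = b := by
  induction hb using Submodule.span_induction with
  | mem b hb => exact exists_ι_eq hb
  | zero => exact ⟨0, map_zero _⟩
  | add b c _ _ hb hc =>
    obtain ⟨a, rfl⟩ := hb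
    obtain ⟨a', rfl⟩ := hc
    exact ⟨a + a', map_add _ _ _⟩
  | smul n b _ hb =>
    obtain ⟨a, rfl⟩ := hb
    exact ⟨n • a, map_nsmul _ _ _⟩

lemma supported_mono {S T : Finset Γ} (h : S ⊆ T) : supported V H S ≤ supported V H T :=
  biSup_mono fun _ hg => h hg

open scoped Pointwise in
lemma mul_mem_supported {S T : Finset Γ} {b c : CrossedProduct V H} (hb : b ∈ supported V H S)
    (hc : c ∈ supported V H T) : b * c ∈ supported V H (S + T) := by
  have := Submodule.mul_mem_mul hb hc
  simp only [supported, Submodule.iSup_mul, Submodule.mul_iSup] at this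
  refine (?_ : _ ≤ supported V H (S + T)) this
  simp only [iSup_le_iff, Submodule.mul_le]
  intros
  exact Submodule.mem_iSup_of_mem _ (Submodule.mem_iSup_of_mem (Finset.add_mem_add ‹_› ‹_›)
    (mul_mem_homogeneous ‹_› ‹_›))

lemma supported_le_C₀ {S : Finset Γ} {b : CrossedProduct V H} (hb : b ∈ supported V H S) :
    b ∈ C₀ V H := by
  let N : Submodule ℕ (CrossedProduct V H) :=
    (C₀ V H).toSubalgebra.toSubmodule.toAddSubmonoid.toNatSubmodule
  have : supported V H S ≤ N :=
    iSup₂_le fun g _ => Submodule.span_le.2 (monomials_subset_C₀ g)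
  exact this hb

lemma monomials_le_supported (g : Γ) {b : CrossedProduct V H} (hb : b ∈ monomials V H g) :
    b ∈ supported V H {g} := by
  have : b ∈ homogeneous V H g := Submodule.subset_span hb
  simpa [supported] using this

/-- Provides a dense set of elements with a finite homogeneous decomposition. -/
lemma exists_mem_supported (f : Pre V H) : ∃ S : Finset Γ, mk f ∈ supported V H S := by
  classical
  induction f using Pre.induction with
  | h1 l c =>
    induction l using FreeMonoid.recOn with
    | one =>
      refine ⟨_, monomials_le_supported 0 ?_⟩
      -- The scalar of a word is carried down to the empty word, where it becomes the element `c •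
      -- 1` of `A`, of degree zero.
      have : (mk (Pre.word 1 c : Pre V H) : CrossedProduct V H) = ι (c • (1 : A)) := by
        rw [map_smul, map_one, ← mk_one, ← mk_smul, Pre.one_eq, Pre.smul_word, mul_one]
      rw [this]
      exact ι_mem _
    | of_mul g l ih =>
      obtain ⟨S, hS⟩ := ih
      have : (Pre.word (FreeMonoid.of g * l) c : Pre V H) =
          Pre.word (FreeMonoid.of g) 1 * Pre.word l c := by rw [Pre.word_mul, one_mul]
      rw [this, mk_mul]
      cases g with
      | alg a => exact ⟨_, mul_mem_supported (monomials_le_supported _ (ι_mem a)) hS⟩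
      | iso x => exact ⟨_, mul_mem_supported (monomials_le_supported _ (Uhat_mem x)) hS⟩
      | isoStar x =>
        rw [← Pre.star_iso, ← star_mk]
        exact ⟨_, mul_mem_supported (monomials_le_supported _ (star_Uhat_mem x)) hS⟩
  | h2 f g hf hg =>
    obtain ⟨S, hS⟩ := hf
    obtain ⟨T, hT⟩ := hg
    refine ⟨S ∪ T, ?_⟩
    rw [mk_add]
    exact add_mem (supported_mono Finset.subset_union_left hS)
      (supported_mono Finset.subset_union_right hT)

end CrossedProduct

/-- Characters of finite order separate a point of an abelian group from zero. -/
lemma exists_addChar_circle {Γ : Type*} [AddCommGroup Γ] {x : Γ} (hx : x ≠ 0) :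
    ∃ (u : AddChar Γ Circle) (n : ℕ), n ≠ 0 ∧ u x ^ n = 1 ∧ u x ≠ 1 := by
  -- Here `χ` takes values in `ℚ/ℤ`, which is then mapped to the circle by `q ↦ exp(2πiq)`. Rational
  -- values make `u x` a root of unity, so that a finite average can replace integration over the
  -- dual group.
  obtain ⟨χ, hχ⟩ := CharacterModule.exists_character_apply_ne_zero_of_ne_zero hx
  let e : ℚ →+ Additive Circle :=
    Circle.expHom.comp ((AddMonoidHom.mulLeft (2 * Real.pi)).comp (Rat.castHom ℝ).toAddMonoidHom)
  have he : ∀ q : ℚ, e q = Additive.ofMul (Circle.exp (2 * Real.pi * q)) := fun q => rfl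
  let e' : AddCircle (1 : ℚ) →+ Additive Circle := QuotientAddGroup.lift _ e <| by
    intro q hq
    obtain ⟨m, rfl⟩ := AddSubgroup.mem_zmultiples_iff.1 hq
    rw [AddMonoidHom.mem_ker, he, ← ofMul_one]
    congr 1
    rw [← Circle.exp_zero, Circle.exp_eq_exp]
    exact ⟨m, by push_cast [zsmul_eq_mul]; ring⟩
  obtain ⟨q, hq⟩ := QuotientAddGroup.mk_surjective (χ x)
  let u : AddChar Γ Circle := AddChar.toAddMonoidHomEquiv.symm (e'.comp χ)
  have hu : u x = Circle.exp (2 * Real.pi * q) := by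
    change (e' (χ x)).toMul = _
    rw [← hq]
    rfl
  -- With `q` a rational representative of `χ x`, the denominator of `q` is an exponent for `u x`,
  -- and `u x = 1` would make `q` an integer, against `χ x ≠ 0`.
  refine ⟨u, q.den, q.den_nz, ?_, fun h => hχ ?_⟩
  · rw [hu, ← Circle.exp_nsmul, ← Circle.exp_zero, Circle.exp_eq_exp]
    refine ⟨q.num, ?_⟩
    have : (q : ℝ) * q.den = q.num := by exact_mod_cast Rat.mul_den_eq_num q
    rw [nsmul_eq_mul, ← this]
    ring
  · rw [hu, ← Circle.exp_zero, Circle.exp_eq_exp] at h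
    obtain ⟨m, hm⟩ := h
    have h2 : (q : ℝ) = m := by
      refine mul_left_cancel₀ Real.two_pi_pos.ne' ?_
      linarith
    have h3 : q = m := by exact_mod_cast h2
    rw [← hq, h3]
    exact (QuotientAddGroup.eq_zero_iff _).2 (AddSubgroup.mem_zmultiples_iff.2 ⟨m, by simp⟩)

namespace CrossedProduct

variable {Γ : Type v} [AddCommGroup Γ] [LinearOrder Γ] [IsOrderedAddMonoid Γ]
variable {A : Type u} [CStarAlgebra A] [PartialOrder A] [StarOrderedRing A]
variable {V H : Action Γ A}

/-! ### The gauge action -/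

/-- A covariant representation is what prevents the universal relations from collapsing `A`: the
injective map `σ` factors through `ι`. -/
lemma ι_injective {C : Type w} [CStarAlgebra C] (R : CovariantRep V C)
    (h : IsCompleteInteraction V H) :
    Function.Injective (ι : A →⋆ₐ[ℂ] CrossedProduct V H) := fun a b hab =>
  R.injective (by rw [← R.integrated_ι h, hab, R.integrated_ι])

lemma circle_mul_star (z : Circle) : (z : ℂ) * star (z : ℂ) = 1 := by
  exact (Complex.mul_conj (z : ℂ)).trans (by simp)

lemma circle_star_mul (z : Circle) : star (z : ℂ) * (z : ℂ) = 1 := by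
  rw [mul_comm, circle_mul_star]

/-- The universal covariant representation twisted by a character. -/
noncomputable def twist (hι : Function.Injective (ι : A →⋆ₐ[ℂ] CrossedProduct V H))
    (u : AddChar Γ Circle) : CovariantRep V (CrossedProduct V H) where
  σ := ι
  injective := hι
  U x := (u x : ℂ) • Uhat x
  U_add x y := by
    rw [Nonneg.coe_add, AddChar.map_add_eq_mul, Circle.coe_mul, Uhat_add, smul_mul_smul_comm]
  partialIsometry x := by
    rw [star_smul, smul_mul_smul_comm, smul_mul_smul_comm, circle_mul_star, one_mul,
      Uhat_mul_star_mul]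
  map_action x a := by
    rw [star_smul, smul_mul_assoc, smul_mul_smul_comm, circle_mul_star, one_smul, ι_left]
  mem_range x a := ⟨H x a, by
    rw [star_smul, smul_mul_assoc, smul_mul_smul_comm, circle_star_mul, one_smul, ι_right]⟩

/-- The gauge endomorphism `a ↦ a`, `Û_x ↦ u(x) Û_x` of the crossed product. -/
noncomputable def gauge (hι : Function.Injective (ι : A →⋆ₐ[ℂ] CrossedProduct V H))
    (h : IsCompleteInteraction V H) (u : AddChar Γ Circle) :
    CrossedProduct V H →⋆ₐ[ℂ] CrossedProduct V H :=
  (twist hι u).integrated h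

section Gauge

variable (hι : Function.Injective (ι : A →⋆ₐ[ℂ] CrossedProduct V H))
  (h : IsCompleteInteraction V H) (u : AddChar Γ Circle)

lemma gauge_ι (a : A) : gauge hι h u (ι a) = ι a := (twist hι u).integrated_ι h a

lemma gauge_Uhat (x : PosCone Γ) : gauge hι h u (Uhat x) = (u x : ℂ) • Uhat x :=
  (twist hι u).integrated_Uhat h x

lemma gauge_star_Uhat (x : PosCone Γ) :
    gauge hι h u (star (Uhat x)) = (u (-x) : ℂ) • star (Uhat x) := by
  rw [map_star, gauge_Uhat, star_smul, AddChar.map_neg_eq_inv, Circle.coe_inv_eq_conj]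
  rfl

lemma gauge_pos {x : PosCone Γ} {q : CrossedProduct V H} (hq : q ∈ posQuasiMonomials V H x) :
    gauge hι h u q = (u x : ℂ) • q := by
  induction hq using AddSubmonoid.closure_induction with
  | mem q hq =>
    obtain ⟨l, rfl, rfl⟩ := hq
    induction l with
    | nil => simp [degree, posMonomial]
    | cons p l ih =>
      rw [posMonomial_cons, map_mul, map_mul, ih, gauge_ι, gauge_Uhat, degree_cons,
        Nonneg.coe_add, AddChar.map_add_eq_mul, Circle.coe_mul, mul_smul_comm,
        mul_smul_comm, smul_mul_assoc, smul_smul, mul_comm]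
  | zero => simp
  | add q r _ _ hq hr => rw [map_add, hq, hr, smul_add]

lemma gauge_neg {x : PosCone Γ} {q : CrossedProduct V H} (hq : q ∈ negQuasiMonomials V H x) :
    gauge hι h u q = (u (-x) : ℂ) • q := by
  induction hq using AddSubmonoid.closure_induction with
  | mem q hq =>
    obtain ⟨l, rfl, rfl⟩ := hq
    induction l with
    | nil => simp [degree, negMonomial]
    | cons p l ih =>
      rw [negMonomial_cons, map_mul, map_mul, ih, gauge_ι, gauge_star_Uhat, degree_cons,
        Nonneg.coe_add, neg_add, AddChar.map_add_eq_mul, Circle.coe_mul, mul_smul_comm,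
        mul_smul_comm, smul_mul_assoc, smul_smul, mul_comm]
  | zero => simp
  | add q r _ _ hq hr => rw [map_add, hq, hr, smul_add]

/-- The average of the gauge endomorphisms given by `1, u, …, uⁿ⁻¹`. -/
noncomputable def gaugeMean (n : ℕ) : CrossedProduct V H →ₗ[ℂ] CrossedProduct V H :=
  (n : ℂ)⁻¹ • ∑ k ∈ Finset.range n, (gauge hι h (u ^ k)).toAlgHom.toLinearMap

lemma gaugeMean_apply (n : ℕ) (b : CrossedProduct V H) :
    gaugeMean hι h u n b = (n : ℂ)⁻¹ • ∑ k ∈ Finset.range n, gauge hι h (u ^ k) b := by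
  simp [gaugeMean]

lemma norm_gaugeMean_le {n : ℕ} (hn : n ≠ 0) (b : CrossedProduct V H) :
    ‖gaugeMean hι h u n b‖ ≤ ‖b‖ := by
  have hn' : (0 : ℝ) < n := by positivity
  rw [gaugeMean_apply, norm_smul, norm_inv, Complex.norm_natCast, inv_mul_le_iff₀ hn']
  refine (norm_sum_le _ _).trans ?_
  refine (Finset.sum_le_card_nsmul _ _ ‖b‖ fun k _ =>
    NonUnitalStarAlgHom.norm_apply_le (gauge hι h (u ^ k)) b).trans ?_
  simp

lemma gaugeMean_ι {n : ℕ} (hn : n ≠ 0) (a : A) : gaugeMean hι h u n (ι a) = ι a := by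
  have hn' : (n : ℂ) ≠ 0 := by exact_mod_cast hn
  simp only [gaugeMean_apply, gauge_ι, Finset.sum_const, Finset.card_range]
  rw [← Nat.cast_smul_eq_nsmul ℂ, smul_smul, inv_mul_cancel₀ hn', one_smul]

/-- The scalar is an average of powers, hence zero when `u g` is a nontrivial `n`-th root of unity.
-/
lemma gaugeMean_of_eigen (n : ℕ) {g : Γ} {q : CrossedProduct V H}
    (hq : ∀ u, gauge hι h u q = (u g : ℂ) • q) :
    gaugeMean hι h u n q = ((n : ℂ)⁻¹ * ∑ k ∈ Finset.range n, (u g : ℂ) ^ k) • q := by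
  simp only [gaugeMean_apply, hq, AddChar.pow_apply, Circle.coe_pow, mul_smul, Finset.sum_smul]

lemma geom_sum_circle {z : Circle} {n : ℕ} (h1 : z ^ n = 1) (h2 : z ≠ 1) :
    ∑ k ∈ Finset.range n, (z : ℂ) ^ k = 0 := by
  have hz : (z : ℂ) - 1 ≠ 0 := sub_ne_zero.2 fun h => h2 (Circle.ext h)
  have := geom_sum_mul (z : ℂ) n
  rw [← Circle.coe_pow, h1, Circle.coe_one, sub_self] at this
  exact (mul_eq_zero.1 this).resolve_right hz

/-- Each gauge mean removes one `x` from `F`, fixes `ι a`, does not increase the norm, and rescales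
the other terms. The hypotheses speak of joint eigenvectors because that property plainly survives
rescaling and so feeds the induction. -/
lemma norm_ι_le_of_eigen (F : Finset (PosCone Γ)) (qneg qpos : PosCone Γ → CrossedProduct V H)
    (h0 : ∀ x ∈ F, x ≠ 0) (hneg : ∀ x ∈ F, ∀ u, gauge hι h u (qneg x) = (u (-x) : ℂ) • qneg x)
    (hpos : ∀ x ∈ F, ∀ u, gauge hι h u (qpos x) = (u x : ℂ) • qpos x) (a : A) :
    ‖(ι a : CrossedProduct V H)‖ ≤ ‖∑ x ∈ F, qneg x + ι a + ∑ x ∈ F, qpos x‖ := by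
  classical
  induction F using Finset.induction_on generalizing qneg qpos with
  | empty => simp
  | insert x F hx ih =>
    have hx0 : (x : Γ) ≠ 0 := fun hx0 => h0 x (Finset.mem_insert_self x F) (Subtype.ext hx0)
    obtain ⟨u, n, hn, hu1, hu2⟩ := exists_addChar_circle hx0
    -- The inverse of a nontrivial `n`-th root of unity is another one, so the same mean kills the
    -- degrees `x` and `-x`.
    have hu3 : u (-x) ≠ 1 := by rwa [AddChar.map_neg_eq_inv, Ne, inv_eq_one]
    have hu4 : u (-x) ^ n = 1 := by rw [AddChar.map_neg_eq_inv, inv_pow, hu1, inv_one]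
    have hm : ∀ y ∈ F, y ∈ insert x F := fun y hy => Finset.mem_insert_of_mem hy
    refine (ih (fun y => gaugeMean hι h u n (qneg y)) (fun y => gaugeMean hι h u n (qpos y))
      (fun y hy => h0 y (hm y hy)) (fun y hy v => ?_) (fun y hy v => ?_)).trans ?_
    · rw [gaugeMean_of_eigen hι h u n (hneg y (hm y hy)), map_smul, hneg y (hm y hy), smul_comm]
    · rw [gaugeMean_of_eigen hι h u n (hpos y (hm y hy)), map_smul, hpos y (hm y hy), smul_comm]
    · refine le_trans (le_of_eq ?_) (norm_gaugeMean_le hι h u hn _)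
      rw [Finset.sum_insert hx, Finset.sum_insert hx]
      simp only [map_add, map_sum]
      rw [gaugeMean_of_eigen hι h u n (hneg x (Finset.mem_insert_self x F)),
        gaugeMean_of_eigen hι h u n (hpos x (Finset.mem_insert_self x F)), gaugeMean_ι hι h u hn,
        geom_sum_circle hu1 hu2, geom_sum_circle hu4 hu3]
      simp

include hι in
lemma norm_ι (a : A) : ‖(ι a : CrossedProduct V H)‖ = ‖a‖ :=
  NonUnitalStarAlgHom.norm_map (ι : A →⋆ₐ[ℂ] CrossedProduct V H) hι a

include hι h in
/-- The map `E₀` is contractive. -/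
lemma norm_le_of_isE₀ {b : CrossedProduct V H} {a : A} (hb : IsE₀ b a) : ‖a‖ ≤ ‖b‖ := by
  obtain ⟨F, qneg, qpos, hq, rfl⟩ := hb
  rw [← norm_ι hι a]
  exact norm_ι_le_of_eigen hι h F qneg qpos (fun x hx => (hq x hx).1)
    (fun x hx u => gauge_neg hι h u (hq x hx).2.1) (fun x hx u => gauge_pos hι h u (hq x hx).2.2) a

end Gauge

end CrossedProduct

/-! ### Polynomial versus exponential growth -/

/-- A comparison of powers up to a polynomial factor is a comparison of the bases. -/
lemma le_of_pow_le_mul_pow {s r : ℝ} (hr : 0 ≤ r) (m : ℕ)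
    (h : ∀ n : ℕ, s ^ 2 ^ n ≤ ((2 ^ n + 1 : ℕ) : ℝ) ^ m * r ^ 2 ^ n) : s ≤ r := by
  by_contra! hlt
  rcases hr.eq_or_lt with rfl | hr
  -- For `r = 0` the exponent `2 ^ 0 = 1` already gives `s ≤ 0`.
  · have := h 0
    simp at this
    linarith
  have hq : 1 < s / r := (one_lt_div hr).2 hlt
  -- `k ^ m / (s / r) ^ k` tends to zero along `k = 2 ^ n + 1`. The shift by one matches the
  -- polynomial factor and costs one extra `s / r` in the denominator, which the threshold `(s /
  -- r)⁻¹` compensates.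
  have ht := (tendsto_pow_const_div_const_pow_of_one_lt m hq).comp (Filter.tendsto_add_atTop_nat 1)
  have ht2 := ht.comp (tendsto_pow_atTop_atTop_of_one_lt (one_lt_two : 1 < 2))
  have hpos : 0 < (s / r)⁻¹ := by positivity
  obtain ⟨n, hn⟩ := (ht2.eventually_lt_const hpos).exists
  have h1 := h n
  simp only [Function.comp_apply] at hn
  rw [div_lt_iff₀ (by positivity), pow_succ', inv_mul_cancel_left₀ (by positivity), div_pow,
    lt_div_iff₀ (by positivity)] at hn
  linarith

open scoped Pointwise in
/-- Iterated sumsets of a finite set in an abelian group have polynomial growth. -/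
lemma exists_growth {G : Type*} [AddCommGroup G] [DecidableEq G] (S : Finset G) :
    ∃ P : ℕ → Finset G, 0 ∈ P 0 ∧ (∀ n, P n + S ⊆ P (n + 1)) ∧ ∀ n, (P n).card ≤ (n + 1) ^ S.card := by
  -- By commutativity a sum of `n` elements of `S` depends only on multiplicities. `P n` consists of
  -- all combinations with multiplicities at most `n`, a box with `(n + 1) ^ |S|` points.
  refine ⟨fun n => (Fintype.piFinset fun _ : S => Finset.range (n + 1)).image
    fun f => ∑ s : S, f s • (s : G), ?_, fun n => ?_, fun n => ?_⟩
  · exact Finset.mem_image.2 ⟨0, Fintype.mem_piFinset.2 (by simp), by simp⟩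
  · intro g hg
    obtain ⟨_, ha, t, ht, rfl⟩ := Finset.mem_add.1 hg
    obtain ⟨f, hf, rfl⟩ := Finset.mem_image.1 ha
    refine Finset.mem_image.2 ⟨f + Pi.single ⟨t, ht⟩ 1, ?_, ?_⟩
    · rw [Fintype.mem_piFinset] at hf ⊢
      intro s
      have := Finset.mem_range.1 (hf s)
      have h1 : (Pi.single ⟨t, ht⟩ 1 : S → ℕ) s ≤ 1 := by
        rw [Pi.single_apply]; split_ifs <;> simp
      rw [Finset.mem_range, Pi.add_apply]
      omega
    · simp [add_smul, Finset.sum_add_distrib, Pi.single_apply, ite_smul]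
  · refine Finset.card_image_le.trans ?_
    simp

namespace CrossedProduct

variable {Γ : Type v} [AddCommGroup Γ] [LinearOrder Γ] [IsOrderedAddMonoid Γ]
variable {A : Type u} [CStarAlgebra A] [PartialOrder A] [StarOrderedRing A]
variable {V H : Action Γ A}

/-! ### The component of degree zero -/

lemma isE₀_ι (a : A) : IsE₀ (ι a : CrossedProduct V H) a :=
  ⟨∅, 0, 0, by simp, by simp⟩

lemma IsE₀.add {b c : CrossedProduct V H} {a d : A} (hb : IsE₀ b a) (hc : IsE₀ c d) :
    IsE₀ (b + c) (a + d) := by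
  classical
  obtain ⟨F, p, q, h, rfl⟩ := hb
  obtain ⟨F', p', q', h', rfl⟩ := hc
  -- The families are unconstrained outside their index sets, so they are cut off by zero before
  -- being added over the union.
  refine ⟨F ∪ F', fun x => (if x ∈ F then p x else 0) + if x ∈ F' then p' x else 0,
    fun x => (if x ∈ F then q x else 0) + if x ∈ F' then q' x else 0, fun x hx => ⟨?_, ?_, ?_⟩, ?_⟩
  · rcases Finset.mem_union.1 hx with hx | hx
    · exact (h x hx).1
    · exact (h' x hx).1
  · refine add_mem ?_ ?_ <;> split_ifs with hx
    exacts [(h x hx).2.1, zero_mem _, (h' x hx).2.1, zero_mem _]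
  · refine add_mem ?_ ?_ <;> split_ifs with hx
    exacts [(h x hx).2.2, zero_mem _, (h' x hx).2.2, zero_mem _]
  · simp only [Finset.sum_add_distrib, Finset.sum_ite_mem, Finset.union_inter_cancel_left,
      Finset.union_inter_cancel_right, map_add]
    abel

lemma IsE₀.sum {I : Type*} (s : Finset I) (b : I → CrossedProduct V H) (a : I → A)
    (h : ∀ i ∈ s, IsE₀ (b i) (a i)) : IsE₀ (∑ i ∈ s, b i) (∑ i ∈ s, a i) := by
  classical
  induction s using Finset.induction_on with
  | empty => simpa using isE₀_ι (V := V) (H := H) (0 : A)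
  | insert i s hi ih =>
    rw [Finset.sum_insert hi, Finset.sum_insert hi]
    exact (h i (by simp)).add (ih fun j hj => h j (by simp [hj]))

lemma homogeneous_pos {g : Γ} (hg : 0 < g) {b : CrossedProduct V H} (hb : b ∈ homogeneous V H g) :
    b ∈ posQuasiMonomials V H ⟨g, hg.le⟩ := by
  have : homogeneous V H g ≤ (posQuasiMonomials V H ⟨g, hg.le⟩).toNatSubmodule := by
    refine Submodule.span_le.2 ?_
    rintro _ (⟨l, h1, rfl⟩ | ⟨l, h1, rfl⟩)
    · exact AddSubmonoid.subset_closure ⟨l, Subtype.ext h1, rfl⟩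
    · exact absurd (degree l).2 (by rw [h1]; simpa using hg)
  exact this hb

lemma homogeneous_neg {g : Γ} (hg : g < 0) {b : CrossedProduct V H} (hb : b ∈ homogeneous V H g) :
    b ∈ negQuasiMonomials V H ⟨-g, (neg_pos.2 hg).le⟩ := by
  have : homogeneous V H g ≤ (negQuasiMonomials V H ⟨-g, (neg_pos.2 hg).le⟩).toNatSubmodule := by
    refine Submodule.span_le.2 ?_
    rintro _ (⟨l, h1, rfl⟩ | ⟨l, h1, rfl⟩)
    · exact absurd (degree l).2 (by rw [h1]; simpa using hg)
    · exact AddSubmonoid.subset_closure ⟨l, Subtype.ext h1, rfl⟩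
  exact this hb

lemma isE₀_of_homogeneous {g : Γ} (hg : g ≠ 0) {b : CrossedProduct V H}
    (hb : b ∈ homogeneous V H g) : IsE₀ b 0 := by
  rcases hg.lt_or_gt with hg | hg
  · refine ⟨{⟨-g, (neg_pos.2 hg).le⟩}, fun _ => b, 0, ?_, by simp⟩
    intro x hx
    rw [Finset.mem_singleton.1 hx]
    exact ⟨fun h => hg.ne (neg_eq_zero.1 (congrArg Subtype.val h)), homogeneous_neg hg hb,
      zero_mem _⟩
  · refine ⟨{⟨g, hg.le⟩}, 0, fun _ => b, ?_, by simp⟩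
    intro x hx
    rw [Finset.mem_singleton.1 hx]
    exact ⟨fun h => hg.ne' (congrArg Subtype.val h), zero_mem _, homogeneous_pos hg hb⟩

end CrossedProduct

/-! ### Lower norm bounds from property (*) -/

namespace CovariantRep

open CrossedProduct

variable {Γ : Type v} [AddCommGroup Γ] [LinearOrder Γ] [IsOrderedAddMonoid Γ]
variable {A : Type u} [CStarAlgebra A] [PartialOrder A] [StarOrderedRing A]
variable {V H : Action Γ A} {C : Type w} [CStarAlgebra C] {R : CovariantRep V C}
  {h : IsCompleteInteraction V H}

/-- Property (*) applied to `b b⋆` controls `∑ d_g d_g⋆`, and positivity turns this into a bound for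
each component `d_g` separately. The triangle inequality then costs the factor `|S|`. -/
lemma PropertyStar.norm_le_card_mul (hR : R.PropertyStar h) {S : Finset Γ} {b : CrossedProduct V H}
    (hb : b ∈ supported V H S) : ‖b‖ ≤ S.card * ‖R.integrated h b‖ := by
  classical
  have hι := ι_injective R h
  obtain ⟨d, hd⟩ := (Submodule.mem_iSup_finset_iff_exists_sum _ _).1 hb
  have h1 : ∀ g, ∃ a : A, ι a = (d g : CrossedProduct V H) * star (d g : CrossedProduct V H) :=
    fun g => exists_ι_eq_of_homogeneous
      (by simpa using mul_mem_homogeneous (d g).2 (star_mem_homogeneous (d g).2))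
  choose a ha using h1
  -- The twist by the trivial character is the universal representation, whose `σ` is `ι`; being
  -- injective, it reflects positivity.
  have ha0 : ∀ g, 0 ≤ a g := fun g =>
    (twist hι 1).nonneg_of_map_eq (a g) (star (d g : CrossedProduct V H))
      (by rw [star_star]; exact ha g)
  have hE : IsE₀ (b * star b) (∑ g ∈ S, a g) := by
    have e1 : b * star b = ∑ p ∈ S ×ˢ S,
        (d p.1 : CrossedProduct V H) * star (d p.2 : CrossedProduct V H) := by
      rw [← hd, star_sum, Finset.sum_mul_sum, Finset.sum_product]
    -- The diagonal terms carry the degree-zero part; `d_g d_{g'}⋆` with `g ≠ g'` has degree `g - g'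
    -- ≠ 0` and contributes zero.
    have e2 : ∑ g ∈ S, a g = ∑ p ∈ S ×ˢ S, if p.1 = p.2 then a p.1 else 0 := by
      rw [Finset.sum_product]
      exact Finset.sum_congr rfl fun g hg => by simp [hg]
    rw [e1, e2]
    refine IsE₀.sum _ _ _ fun p _ => ?_
    split_ifs with hp
    · rw [← hp, ← ha]
      exact isE₀_ι _
    · refine isE₀_of_homogeneous (g := p.1 + -p.2) (fun h0 => hp (add_neg_eq_zero.1 h0)) ?_
      exact mul_mem_homogeneous (d p.1).2 (star_mem_homogeneous (d p.2).2)
  have hC : b ∈ C₀ V H := supported_le_C₀ hb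
  have h2 := hR _ (mul_mem hC (star_mem hC)) _ hE
  rw [map_mul, map_star, CStarRing.norm_self_mul_star] at h2
  have h3 : ∀ g ∈ S, ‖(d g : CrossedProduct V H)‖ ≤ ‖R.integrated h b‖ := by
    intro g hg
    refine abs_le_of_sq_le_sq' ?_ (norm_nonneg _) |>.2
    rw [sq, sq, ← CStarRing.norm_self_mul_star, ← ha, norm_ι hι]
    refine (CStarAlgebra.norm_le_norm_of_nonneg_of_le (ha0 g) ?_).trans h2
    exact Finset.single_le_sum (fun g _ => ha0 g) hg
  calc ‖b‖ = ‖∑ g ∈ S, (d g : CrossedProduct V H)‖ := by rw [hd]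
    _ ≤ ∑ g ∈ S, ‖(d g : CrossedProduct V H)‖ := norm_sum_le _ _
    _ ≤ S.card * ‖R.integrated h b‖ := by
      rw [← nsmul_eq_mul]
      exact Finset.sum_le_card_nsmul _ _ _ h3

/-- The cardinality bound is applied to `b ^ 2ⁿ`. Self-adjointness of `b` and of its image makes
both norms exact powers, and the `2ⁿ`-th root of a polynomial in `2ⁿ` tends to `1`. -/
lemma PropertyStar.norm_le_of_isSelfAdjoint (hR : R.PropertyStar h) {S : Finset Γ}
    {b : CrossedProduct V H} (hb : b ∈ supported V H S) (hs : IsSelfAdjoint b) :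
    ‖b‖ ≤ ‖R.integrated h b‖ := by
  classical
  obtain ⟨P, h0, hP, hcard⟩ := exists_growth S
  have hmem : ∀ n, b ^ n ∈ supported V H (P n) := by
    intro n
    induction n with
    | zero =>
      rw [pow_zero, ← map_one (ι : A →⋆ₐ[ℂ] CrossedProduct V H)]
      exact supported_mono (by simpa using h0) (monomials_le_supported _ (ι_mem 1))
    | succ n ih =>
      rw [pow_succ]
      exact supported_mono (hP n) (mul_mem_supported ih hb)
  refine le_of_pow_le_mul_pow (norm_nonneg _) S.card fun n => ?_
  rw [← hs.norm_pow_two_pow, ← (hs.map (R.integrated h)).norm_pow_two_pow, ← map_pow]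
  refine (hR.norm_le_card_mul (hmem _)).trans ?_
  gcongr
  exact_mod_cast hcard _

/-- Both sides are continuous, so the dense image of the free ⋆-algebra suffices; there the
C⋆-identity passes from `f` to the self-adjoint `f⋆ f`. -/
lemma PropertyStar.norm_le (hR : R.PropertyStar h) (b : CrossedProduct V H) :
    ‖b‖ ≤ ‖R.integrated h b‖ := by
  induction b using CrossedProduct.induction with
  | hc =>
    exact isClosed_le continuous_norm (R.continuous_integratedRingHom h).norm
  | h f =>
    obtain ⟨S, hS⟩ := exists_mem_supported (star f * f)
    rw [mk_mul, ← star_mk] at hS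
    have := hR.norm_le_of_isSelfAdjoint hS (.star_mul_self _)
    rw [map_mul, map_star, CStarRing.norm_star_mul_self, CStarRing.norm_star_mul_self] at this
    exact (abs_le_of_sq_le_sq' (by rwa [sq, sq]) (norm_nonneg _)).2

end CovariantRep

end SemigroupInteraction

theorem theorem5p4
    {Γ : Type*} [AddCommGroup Γ] [LinearOrder Γ] [IsOrderedAddMonoid Γ]
    {A : Type*} [CStarAlgebra A] [PartialOrder A] [StarOrderedRing A]
    (V H : SemigroupInteraction.Action Γ A)
    (hVH : SemigroupInteraction.IsCompleteInteraction V H)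
    {C : Type*} [CStarAlgebra C] (R : SemigroupInteraction.CovariantRep V C) :
    Function.Injective (R.integrated hVH) ↔ R.PropertyStar hVH := by
  constructor
  · intro hinj b _ a hb
    -- An injective ⋆-homomorphism of C⋆-algebras is isometric, so the claim becomes contractivity
    -- of `E₀`.
    rw [NonUnitalStarAlgHom.norm_map (R.integrated hVH) hinj b]
    exact SemigroupInteraction.CrossedProduct.norm_le_of_isE₀
      (SemigroupInteraction.CrossedProduct.ι_injective R hVH) hVH hb
  · intro hR
    rw [injective_iff_map_eq_zero]
    intro b hb
    have := hR.norm_le b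
    rwa [hb, norm_zero, norm_le_zero_iff] at this
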